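/- Let $r,n\ge 1$, let $p$ divide $r$, and put $\zeta_r=e^{2\pi i/r}$. Let $G(r,n)$ be the group of $n\times n$ complex matrices with exactly one non-zero entry in every row and every column, all non-zero entries being $r$-th roots of unity. An element $g\in G(r,n)$ is identified with the map $i\mapsto \zeta_r^{z_i(g)}\,|g|(i)$, where $|g|\in S_n$, $z_i(g)\in\mathbb Z/r\mathbb Z$, and $\zeta_r^{z_i(g)}$ is the non-zero entry of the $i$-th column, in row $|g|(i)$; products are compositions of maps, and $S_n\subseteq G(r,n)$ consists of the $g$ with all $z_i(g)=0$. Let $G(r,p,n)=\{g\in G(r,n):\sum_i z_i(g)\equiv 0 \bmod p\}$, let $C_p=\langle \zeta_p I\rangle$, and let $G(r,p,n)^*=G(r,1,p,n)=G(r,n)/C_p$ be the dual group. Complex conjugation $v\mapsto\bar v$ is well defined on $G(r,p,n)^*$; let $I(r,p,n)^*=\{v\in G(r,p,n)^*: v\bar v=1\}$ be its set of absolute involutions. An element of $G(r,p,n)^*$ is called symmetric (antisymmetric) if its lifts to $G(r,n)$ are symmetric (antisymmetric) matrices; every absolute involution is of exactly one of these two kinds. For $g\in G(r,p,n)$ and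 $v\in I(r,p,n)^*$ with a lift $\tilde v\in G(r,n)$ put $$\langle g,v\rangle=\sum_{i=1}^n z_i(g)z_i(\tilde v)\in\mathbb Z/r\mathbb Z,\qquad u(g,v)=z_1(\tilde v)-z_{|g|^{-1}(1)}(\tilde v)\in\mathbb Z/r\mathbb Z,$$ and let $\mathrm{inv}_v(g)$ be the number of pairs $\{i,j\}$ with $|\tilde v|(i)=j\ne i$ and $(j-i)(|g|(j)-|g|(i))<0$. These quantities do not depend on the choice of the lift. Theorem. Suppose that $\mathrm{GCD}(p,n)$ is $1$ or $2$. Let $M(r,p,n)^*=\bigoplus_{v\in I(r,p,n)^*}\mathbb C\,C_v$ be the vector space with basis $\{C_v: v\in I(r,p,n)^*\}$. Then $$\varrho(g)(C_v)=\begin{cases}\zeta_r^{\langle g,v\rangle}(-1)^{\mathrm{inv}_v(g)}\,C_{|g|v|g|^{-1}} & \text{if } v \text{ is symmetric},\\ \zeta_r^{\langle g,v\rangle}\,\zeta_r^{u(g,v)}\,C_{|g|v|g|^{-1}} & \text{if } v \text{ is antisymmetric}\end{cases}$$ defines a representation $\varrho$ of $G(r,p,n)$ on $M(r,p,n)^*$,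 and this representation is a $G(r,p,n)$-model: it is the direct sum of all irreducible complex representations of $G(r,p,n)$, each occurring exactly once up to isomorphism. -/

import Mathlib

universe u

/-- The primitive `r`-th root of unity `ζ_r = exp(2πi/r)`. -/
noncomputable def zeta (r : ℕ) : ℂ :=
  Complex.exp (2 * Real.pi * Complex.I / r)

/-- The power `ζ_r ^ a` for `a ∈ ℤ/rℤ`. -/
noncomputable def zetaPow {r : ℕ} (a : ZMod r) : ℂ :=
  zeta r ^ a.val

/-- The elements of the wreath product `G(r,n) = G(r,1,n)`, written as coloured permutations:
`g` is the map `i ↦ ζ_r ^ (color i) · perm i`. Here `perm` is `|g|` and `color i` is `z_i(g)`.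
The corresponding monomial matrix is `ColoredPerm.toMatrix`. The index `i ∈ {1, …, n}` is
represented by `i - 1 : Fin n`. -/
@[ext]
structure ColoredPerm (r n : ℕ) where
  perm : Equiv.Perm (Fin n)
  color : Fin n → ZMod r

namespace ColoredPerm

variable {r n : ℕ}

/-- Composition of coloured permutations, `g * h = g ∘ h`. -/
instance : Mul (ColoredPerm r n) :=
  ⟨fun g h => ⟨g.perm * h.perm, fun i => h.color i + g.color (h.perm i)⟩⟩

instance : One (ColoredPerm r n) :=
  ⟨⟨1, fun _ => 0⟩⟩

instance : Inv (ColoredPerm r n) :=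
  ⟨fun g => ⟨g.perm⁻¹, fun i => -g.color (g.perm⁻¹ i)⟩⟩

@[simp] theorem mul_perm (g h : ColoredPerm r n) : (g * h).perm = g.perm * h.perm := rfl

@[simp] theorem mul_color (g h : ColoredPerm r n) (i : Fin n) :
    (g * h).color i = h.color i + g.color (h.perm i) := rfl

@[simp] theorem one_perm : (1 : ColoredPerm r n).perm = 1 := rfl

@[simp] theorem one_color (i : Fin n) : (1 : ColoredPerm r n).color i = 0 := rfl

@[simp] theorem inv_perm (g : ColoredPerm r n) : g⁻¹.perm = g.perm⁻¹ := rfl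

@[simp] theorem inv_color (g : ColoredPerm r n) (i : Fin n) :
    g⁻¹.color i = -g.color (g.perm⁻¹ i) := rfl

instance : Group (ColoredPerm r n) where
  mul_assoc a b c := by
    ext i
    · simp
    · simp [add_assoc]
  one_mul a := by
    ext i
    · simp
    · simp
  mul_one a := by
    ext i
    · simp
    · simp
  inv_mul_cancel a := by
    ext i
    · simp
    · simp

/-- The monomial matrix of `g`: the non-zero entry of the `i`-th column is `ζ_r ^ z_i(g)`, in
row `|g|(i)`. -/
noncomputable def toMatrix (g : ColoredPerm r n) : Matrix (Fin n) (Fin n) ℂ :=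
  Matrix.of fun j i => if j = g.perm i then zetaPow (g.color i) else 0

/-- `g` is symmetric: its matrix is symmetric. -/
def IsSymm (g : ColoredPerm r n) : Prop := g.toMatrix.transpose = g.toMatrix

/-- `g` is antisymmetric: its matrix is antisymmetric. -/
def IsAntisymm (g : ColoredPerm r n) : Prop := g.toMatrix.transpose = -g.toMatrix

/-- The permutation `|g|`, regarded as an element of `G(r,n)`. -/
def abs (g : ColoredPerm r n) : ColoredPerm r n := ⟨g.perm, fun _ => 0⟩

/-- Complex conjugation `g ↦ ḡ` of `G(r,n)`. -/
def bar : ColoredPerm r n →* ColoredPerm r n where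
  toFun g := ⟨g.perm, fun i => -g.color i⟩
  map_one' := by
    ext i
    · rfl
    · simp
  map_mul' g h := by
    ext i
    · rfl
    · simp [add_comm]

/-- `⟨g, h⟩ = ∑ i, z_i(g) z_i(h)`, an element of `ℤ/rℤ`. -/
def pairing (g h : ColoredPerm r n) : ZMod r := ∑ i, g.color i * h.color i

/-- `inv_v(g)`: the number of pairs `{i, j}` with `|v|(i) = j ≠ i` that are inversions
of `|g|`. -/
def invCount (v g : ColoredPerm r n) : ℕ :=
  (Finset.univ.filter fun x : Fin n × Fin n =>
    x.1 < x.2 ∧ g.perm x.2 < g.perm x.1 ∧ v.perm x.1 = x.2).card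

/-- `u(g, v) = z_1(v) - z_{|g|⁻¹(1)}(v)`, an element of `ℤ/rℤ`. -/
def uDiff [NeZero n] (g v : ColoredPerm r n) : ZMod r :=
  v.color 0 - v.color (g.perm⁻¹ 0)

end ColoredPerm

/-- For `p ∣ r`, the group `G(r,p,n)` of the `g ∈ G(r,n)` with `∑ z_i(g) ≡ 0 mod p`; see
`mem_reflGroup_iff_det` for the description by determinants. -/
def reflGroup (r p n : ℕ) : Subgroup (ColoredPerm r n) where
  carrier := {g | (p : ZMod r) ∣ ∑ i, g.color i}
  one_mem' := by simp
  mul_mem' {g h} hg hh := by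
    have e : ∑ i, (g * h).color i = ∑ i, h.color i + ∑ i, g.color i := by
      simp only [ColoredPerm.mul_color, Finset.sum_add_distrib]
      congr 1
      exact Equiv.sum_comp h.perm g.color
    simp only [Set.mem_ofPred_eq] at *
    rw [e]
    exact dvd_add hh hg
  inv_mem' {g} hg := by
    have e : ∑ i, g⁻¹.color i = -∑ i, g.color i := by
      simp only [ColoredPerm.inv_color, Finset.sum_neg_distrib]
      congr 1
      exact Equiv.sum_comp g.perm⁻¹ g.color
    simp only [Set.mem_ofPred_eq] at *
    rw [e]
    exact (dvd_neg).2 hg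

/-- For `p ∣ r`, the generator `ζ_p I = ζ_r ^ (r / p) I` of the scalar subgroup `C_p`. -/
def scalarGen (r p n : ℕ) : ColoredPerm r n := ⟨1, fun _ => ((r / p : ℕ) : ZMod r)⟩

/-- The scalar subgroup `C_p = ⟨ζ_p I⟩` of `G(r,n)`. -/
def scalarSubgroup (r p n : ℕ) : Subgroup (ColoredPerm r n) :=
  Subgroup.zpowers (scalarGen r p n)

instance (r p n : ℕ) : (scalarSubgroup r p n).Normal := by
  constructor
  rintro x ⟨k, rfl⟩ g
  refine ⟨k, ?_⟩
  have h : Commute g (scalarGen r p n) := by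
    change g * _ = _ * g
    ext i
    · simp [scalarGen]
    · simp [scalarGen, add_comm]
  simp only
  rw [(h.zpow_right k).eq, mul_inv_cancel_right]

/-- The dual group `G(r,p,n)* = G(r,1,p,n) = G(r,n) / C_p`. -/
abbrev DualGroup (r p n : ℕ) : Type := ColoredPerm r n ⧸ scalarSubgroup r p n

namespace DualGroup

variable {r p n : ℕ}

/-- Complex conjugation on the dual group. -/
def bar : DualGroup r p n →* DualGroup r p n :=
  QuotientGroup.map _ _ ColoredPerm.bar (by
    rintro x ⟨k, rfl⟩
    refine ⟨-k, ?_⟩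
    have h : ColoredPerm.bar (scalarGen r p n) = (scalarGen r p n)⁻¹ := by
      ext i
      · simp [scalarGen, ColoredPerm.bar]
      · simp [scalarGen, ColoredPerm.bar]
    simp only [map_zpow, h, inv_zpow', zpow_neg])

/-- `v` is an absolute involution: `v v̄ = 1`. -/
def IsAbsInv (v : DualGroup r p n) : Prop := v * bar v = 1

end DualGroup

/-- The set `I(r,p,n)*` of absolute involutions of the dual group of `G(r,p,n)`. -/
abbrev AbsInv (r p n : ℕ) : Type := {v : DualGroup r p n // v.IsAbsInv}

/-- The absolute involution `|g| v |g|⁻¹`. -/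
def AbsInv.conj {r p n : ℕ} (g : ColoredPerm r n) (v : AbsInv r p n) : AbsInv r p n :=
  ⟨(g.abs : DualGroup r p n) * v.1 * (g.abs : DualGroup r p n)⁻¹, by
    have h : DualGroup.bar (g.abs : DualGroup r p n) = (g.abs : DualGroup r p n) := by
      change ((ColoredPerm.bar g.abs : ColoredPerm r n) : DualGroup r p n) = _
      congr 1
      ext i
      · rfl
      · simp [ColoredPerm.bar, ColoredPerm.abs]
    have hv : v.1 * DualGroup.bar v.1 = 1 := v.2
    unfold DualGroup.IsAbsInv
    rw [map_mul, map_mul, map_inv, h]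
    simp only [mul_assoc, inv_mul_cancel_left]
    rw [← mul_assoc v.1, hv, one_mul, mul_inv_cancel]⟩

/-- The formal vector space `M(r,p,n)*` with basis `C_v`, `v ∈ I(r,p,n)*`. -/
abbrev ModelSpace (r p n : ℕ) : Type := AbsInv r p n →₀ ℂ

/-- The basis vector `C_v`. -/
noncomputable def basisC {r p n : ℕ} (v : AbsInv r p n) : ModelSpace r p n := Finsupp.single v 1

/-- A representation of a finite group `G` is a `G`-model: it is the (internal) direct sum of
pairwise non-isomorphic irreducible subrepresentations, and every irreducible complex
representation of `G` is isomorphic to one of them. -/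
def IsModel {G M : Type*} [Group G] [AddCommGroup M] [Module ℂ M]
    (ρ : Representation ℂ G M) : Prop :=
  ∃ (m : ℕ) (W : Fin m → Subrepresentation ρ),
    DirectSum.IsInternal (fun i => (W i).toSubmodule) ∧
    (∀ i, (W i).toRepresentation.IsIrreducible) ∧
    (∀ i j, Nonempty ((W i).toRepresentation.Equiv (W j).toRepresentation) → i = j) ∧
    ∀ (V : Type u) [AddCommGroup V] [Module ℂ V] (σ : Representation ℂ G V),
      σ.IsIrreducible → ∃ i, Nonempty (σ.Equiv (W i).toRepresentation)

/-! Coloured permutations and monomial matrices. -/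

theorem zetaPow_eq_stdAddChar {r : ℕ} [NeZero r] (a : ZMod r) :
    zetaPow a = ZMod.stdAddChar a := by
  obtain ⟨k, rfl⟩ : ∃ k : ℤ, (k : ZMod r) = a := ⟨a.val, by simp⟩
  conv_rhs => rw [← ZMod.natCast_zmod_val (k : ZMod r), ← Int.cast_natCast, ZMod.stdAddChar_coe]
  rw [zetaPow, zeta, ← Complex.exp_nat_mul]
  congr 1
  push_cast
  ring

theorem zetaPow_add {r : ℕ} [NeZero r] (a b : ZMod r) :
    zetaPow (a + b) = zetaPow a * zetaPow b := by
  simp only [zetaPow_eq_stdAddChar, AddChar.map_add_eq_mul]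

theorem zetaPow_ne_zero {r : ℕ} (a : ZMod r) : zetaPow a ≠ 0 :=
  pow_ne_zero _ (Complex.exp_ne_zero _)

namespace ColoredPerm

variable {r n : ℕ} [NeZero r]

theorem toMatrix_mul (g h : ColoredPerm r n) :
    (g * h).toMatrix = g.toMatrix * h.toMatrix := by
  ext j i
  rw [Matrix.mul_apply, Finset.sum_eq_single (h.perm i)]
  · simp only [toMatrix, Matrix.of_apply, mul_perm, Equiv.Perm.mul_apply, mul_color, zetaPow_add]
    split_ifs <;> ring
  · intro k _ hk
    simp [toMatrix, hk]
  · simp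

theorem toMatrix_injective : Function.Injective (toMatrix : ColoredPerm r n → _) := by
  intro g h e
  have e' : ∀ j i, (if j = g.perm i then zetaPow (g.color i) else 0)
      = if j = h.perm i then zetaPow (h.color i) else 0 := fun j i => congrFun (congrFun e j) i
  have hp : ∀ i, g.perm i = h.perm i := by
    intro i
    by_contra hne
    have := e' (g.perm i) i
    rw [if_pos rfl, if_neg hne] at this
    exact zetaPow_ne_zero _ this
  ext i
  · rw [hp i]
  · have := e' (g.perm i) i
    rw [if_pos rfl, if_pos (hp i), zetaPow_eq_stdAddChar, zetaPow_eq_stdAddChar] at this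
    exact ZMod.injective_stdAddChar this

/-- The matrices of the coloured permutations are the monomial matrices whose non-zero entries
are `r`-th roots of unity. -/
theorem exists_toMatrix_eq_iff (A : Matrix (Fin n) (Fin n) ℂ) :
    (∃ g : ColoredPerm r n, g.toMatrix = A) ↔
      (∀ i j, A i j ≠ 0 → A i j ^ r = 1) ∧ (∀ i, ∃! j, A i j ≠ 0) ∧ ∀ j, ∃! i, A i j ≠ 0 := by
  have hz : zeta r ^ r = 1 := (Complex.isPrimitiveRoot_exp r (NeZero.ne r)).pow_eq_one
  constructor
  · rintro ⟨g, rfl⟩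
    have hne : ∀ i j, g.toMatrix i j ≠ 0 ↔ i = g.perm j := by
      intro i j
      by_cases h : i = g.perm j <;> simp [toMatrix, h, zetaPow_ne_zero]
    simp only [hne]
    refine ⟨?_, ?_, ?_⟩
    · rintro i j rfl
      simp only [toMatrix, Matrix.of_apply, if_true, zetaPow]
      rw [← pow_mul, mul_comm, pow_mul, hz, one_pow]
    · intro i
      exact ⟨g.perm⁻¹ i, by simp, fun j hj => by simp [hj]⟩
    · intro j
      exact ⟨g.perm j, rfl, fun i hi => hi⟩
  · rintro ⟨h1, h2, h3⟩
    choose f hf hf' using h3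
    have hbij : Function.Bijective f := by
      rw [Fintype.bijective_iff_injective_and_card]
      refine ⟨fun a b hab => ?_, rfl⟩
      exact (h2 (f a)).unique (hf a) (by rw [hab]; exact hf b)
    have hk : ∀ j, ∃ k : ℕ, k < r ∧ zeta r ^ k = A (f j) j := fun j =>
      (Complex.isPrimitiveRoot_exp r (NeZero.ne r)).eq_pow_of_pow_eq_one (h1 _ _ (hf j))
    choose k hkr hk using hk
    refine ⟨⟨Equiv.ofBijective f hbij, fun j => (k j : ZMod r)⟩, ?_⟩
    ext i j
    simp only [toMatrix, Matrix.of_apply, Equiv.ofBijective_apply]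
    split_ifs with h
    · rw [h, ← hk j, zetaPow, ZMod.val_natCast_of_lt (hkr j)]
    · by_contra hne
      exact h (hf' j i (Ne.symm hne))

theorem det_toMatrix (g : ColoredPerm r n) :
    g.toMatrix.det = g.abs.toMatrix.det * zetaPow (∑ i, g.color i) := by
  have e : g = g.abs * ⟨1, g.color⟩ := by
    ext i
    · rfl
    · simp [abs]
  have hd : (⟨1, g.color⟩ : ColoredPerm r n).toMatrix
      = Matrix.diagonal fun i => zetaPow (g.color i) := by
    ext j i
    by_cases h : j = i
    · subst h
      simp [toMatrix]
    · simp [toMatrix, h]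
  conv_lhs => rw [e, toMatrix_mul, Matrix.det_mul, hd, Matrix.det_diagonal]
  congr 1
  simp only [zetaPow_eq_stdAddChar]
  exact (map_prod (ZMod.stdAddChar (N := r)).toMonoidHom
    (fun i => Multiplicative.ofAdd (g.color i)) Finset.univ).symm

theorem det_abs_ne_zero (g : ColoredPerm r n) : g.abs.toMatrix.det ≠ 0 := by
  intro h
  have e : g.abs * g.abs⁻¹ = 1 := mul_inv_cancel _
  have h1 : (1 : ColoredPerm r n).toMatrix.det = 0 := by
    rw [← e, toMatrix_mul, Matrix.det_mul, h, zero_mul]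
  have h2 : (1 : ColoredPerm r n).toMatrix = 1 := by
    ext j i
    by_cases hji : j = i
    · subst hji
      simp [toMatrix, zetaPow]
    · simp [toMatrix, hji]
  rw [h2, Matrix.det_one] at h1
  exact one_ne_zero h1

/-- `G(r,p,n)` consists of the `A ∈ G(r,n)` such that `det A / det |A|` is an `r/p`-th root of
unity. -/
theorem mem_reflGroup_iff_det {p : ℕ} (hpr : p ∣ r) (g : ColoredPerm r n) :
    g ∈ reflGroup r p n ↔ (g.toMatrix.det / g.abs.toMatrix.det) ^ (r / p) = 1 := by
  rw [det_toMatrix, mul_div_cancel_left₀ _ (det_abs_ne_zero g)]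
  change (p : ZMod r) ∣ ∑ i, g.color i ↔ _
  generalize ∑ i, g.color i = a
  obtain ⟨q, rfl⟩ := hpr
  have hp : 0 < p := Nat.pos_of_ne_zero fun h => NeZero.ne (p * q) (by simp [h])
  have hq : 0 < q := Nat.pos_of_ne_zero fun h => NeZero.ne (p * q) (by simp [h])
  rw [Nat.mul_div_cancel_left _ hp, zetaPow, zeta, ← pow_mul,
    (Complex.isPrimitiveRoot_exp (p * q) (NeZero.ne _)).pow_eq_one_iff_dvd,
    Nat.mul_dvd_mul_iff_right hq]
  constructor
  · rintro ⟨b, rfl⟩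
    rw [← ZMod.natCast_zmod_val b, ← Nat.cast_mul, ZMod.val_natCast]
    exact (Nat.dvd_mod_iff (dvd_mul_right p q)).2 (dvd_mul_right p _)
  · rintro ⟨b, hb⟩
    refine ⟨b, ?_⟩
    rw [← ZMod.natCast_zmod_val a, hb, Nat.cast_mul]

end ColoredPerm

/-! ### Signs attached to pairs of permutations -/

section PairSign

variable {α : Type*}

/-! The character of `ϱ` at `g` is shown to be the number of `h ∈ G(r,p,n)` with `h h̄ = g`; a
twisted Frobenius–Schur argument then gives the model property.

Representation theory. When `GCD(p,n)` is 1 or 2, `ḡ` is conjugate to `g⁻¹`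
(`reflGroup.isConj_inv_bar`). For an irreducible `σ`, the representation `σ ⊗ σ̄`, with `σ̄(g) =
σ(ḡ)`, then has a single invariant line, and the swap of the factors acts on it by a sign, the
indicator of `σ` twisted by conjugation (`twistedIndicator_sq_eq_one`). If the character of `ϱ`
counts the solutions of `h h̄ = g`, this sign is the multiplicity of `σ` in `ϱ`; being non-negative,
it is 1 (`isModel_of_character_eq_card`).

Counting. Put `σ = |g|`. Both the character and the count, multiplied by `p`, become sums over
colour vectors `z` with weight `ζ_r ^ ⟨g, z⟩`: the character because every class in the dual group
has `p` lifts, the count by Fourier analysis on `(ℤ/r)^n` (`mul_card_barRoots`). For each `z` it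
remains to compare a signed number of involutions `s` commuting with `σ` with the number of square
roots of `σ` that translate `z` by a constant killed by `p` (`sum_signed_involutions`). A
translation constant is also killed by `n`, hence by 2, so it is 0 (symmetric case) or the element
of order two (antisymmetric case).

Combinatorial core (`sum_pairSign_eq_card_commRoots`). Sort the `z`-preserving involutions `s` by
the permutation that they induce on the cycles of `σ`. If `s` preserves a cycle with an admissible
half-turn, multiplication by this half-turn reverses the sign, so the fibre sums to 0, and no square
root induces the same permutation of cycles. Otherwise `s` is trivial on the cycles that it
preserves, all signs are 1, and the fibre is in bijection with square roots. -/

theorem prod_range_mul_succ (f : ℕ → ℤ) (hf : ∀ i, f i * f i = 1) (M : ℕ) :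
    ∏ i ∈ Finset.range M, f i * f (i + 1) = f 0 * f M := by
  induction M with
  | zero => simp [hf]
  | succ M ih =>
    rw [Finset.prod_range_succ, ih]
    linear_combination (f 0 * f (M + 1)) * hf M

theorem apply_apply_of_mul_self {s : Equiv.Perm α} (hs : s * s = 1) (x : α) : s (s x) = x := by
  rw [← Equiv.Perm.mul_apply, hs, Equiv.Perm.one_apply]

theorem perm_commute_apply {s σ : Equiv.Perm α} (hc : s * σ = σ * s) (x : α) :
    s (σ x) = σ (s x) := by
  rw [← Equiv.Perm.mul_apply, hc, Equiv.Perm.mul_apply]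

theorem perm_commute_pow_apply {s σ : Equiv.Perm α} (hc : s * σ = σ * s) (i : ℕ) (x : α) :
    s ((σ ^ i) x) = (σ ^ i) (s x) := by
  rw [← Equiv.Perm.mul_apply, (show Commute s σ from hc).pow_right i, Equiv.Perm.mul_apply]

theorem perm_pow_apply_eq_iff_dvd (σ : Equiv.Perm α) (i : ℕ) (x : α) :
    (σ ^ i) x = x ↔ Function.minimalPeriod σ x ∣ i := by
  rw [Equiv.Perm.coe_pow, ← Function.isPeriodicPt_iff_minimalPeriod_dvd]
  rfl

theorem sameCycle_iff_exists_nat_pow [Finite α] {σ : Equiv.Perm α} {x y : α} :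
    σ.SameCycle x y ↔ ∃ i : ℕ, (σ ^ i) x = y :=
  ⟨fun h => h.exists_nat_pow_eq, fun ⟨i, hi⟩ => ⟨i, by simpa using hi⟩⟩

/-- `A` contains exactly one element of each two-element orbit of the involution `s`, and no fixed
point. -/
def IsTransversal (s : Equiv.Perm α) (A : Finset α) : Prop :=
  (∀ x ∈ A, s x ∉ A) ∧ ∀ x, s x ≠ x → x ∈ A ∨ s x ∈ A

theorem IsTransversal.ne {s : Equiv.Perm α} {A : Finset α} (h : IsTransversal s A) {x : α}
    (hx : x ∈ A) : s x ≠ x := fun e => h.1 x hx (by rwa [e])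

variable [LinearOrder α]

/-- `1` if `a < b` and `-1` otherwise. -/
def ltSign (a b : α) : ℤ := if a < b then 1 else -1

theorem ltSign_mul_self (a b : α) : ltSign a b * ltSign a b = 1 := by
  unfold ltSign
  split_ifs <;> rfl

theorem ltSign_swap {a b : α} (h : a ≠ b) : ltSign b a = -ltSign a b := by
  unfold ltSign
  rcases lt_or_gt_of_ne h with h | h <;> simp [h, h.not_gt]

/-- The sign telling whether `σ` changes the relative order of `x` and `y`. -/
theorem ltSign_mul_ltSign_swap (σ : Equiv.Perm α) {x y : α} (h : x ≠ y) :
    ltSign y x * ltSign (σ y) (σ x) = ltSign x y * ltSign (σ x) (σ y) := by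
  rw [ltSign_swap h, ltSign_swap (σ.injective.ne h), neg_mul_neg]

/-- Since `f` is constant on the two-element orbits, the choice of representatives is immaterial:
`x` is matched with whichever of `x`, `s x` lies in the other transversal. -/
theorem IsTransversal.prod_eq {M : Type*} [CommMonoid M] {s : Equiv.Perm α} (hs : s * s = 1)
    {A B : Finset α} (hA : IsTransversal s A) (hB : IsTransversal s B) {f : α → M}
    (hf : ∀ x, s x ≠ x → f (s x) = f x) : ∏ x ∈ A, f x = ∏ x ∈ B, f x := by
  have key : ∀ {A B : Finset α}, IsTransversal s A → IsTransversal s B → ∀ x ∈ A,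
      (if (if x ∈ B then x else s x) ∈ A then (if x ∈ B then x else s x)
        else s (if x ∈ B then x else s x)) = x := by
    intro A B hA hB x hx
    by_cases hxB : x ∈ B
    · simp [hxB, hx]
    · simp [hxB, hA.1 x hx, apply_apply_of_mul_self hs]
  have mem : ∀ {A B : Finset α}, IsTransversal s A → IsTransversal s B → ∀ x ∈ A,
      (if x ∈ B then x else s x) ∈ B := by
    intro A B hA hB x hx
    split_ifs with h
    · exact h
    · exact (hB.2 x (hA.ne hx)).resolve_left h
  refine Finset.prod_bij' (fun x _ => if x ∈ B then x else s x)
    (fun x _ => if x ∈ A then x else s x) (mem hA hB) (mem hB hA) (key hA hB) (key hB hA) ?_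
  intro x hx
  split_ifs
  · rfl
  · exact (hf x (hA.ne hx)).symm

variable [Fintype α]

/-- The product over the two-element orbits `{x, s x}` of `s` of the signs telling whether `σ`
inverts the pair. -/
def pairSign (s σ : Equiv.Perm α) : ℤ := ∏ x with x < s x, ltSign (σ x) (σ (s x))

theorem isTransversal_lt {s : Equiv.Perm α} (hs : s * s = 1) :
    IsTransversal s {x | x < s x} := by
  refine ⟨fun x hx => ?_, fun x hx => ?_⟩
  · simp only [Finset.mem_filter_univ, apply_apply_of_mul_self hs] at *
    exact hx.not_gt
  · simp only [Finset.mem_filter_univ, apply_apply_of_mul_self hs]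
    exact (lt_or_gt_of_ne hx).symm

theorem pairSign_eq_prod {s : Equiv.Perm α} (hs : s * s = 1) {A : Finset α}
    (hA : IsTransversal s A) (σ : Equiv.Perm α) :
    pairSign s σ = ∏ x ∈ A, ltSign x (s x) * ltSign (σ x) (σ (s x)) := by
  rw [hA.prod_eq hs (isTransversal_lt hs)]
  · refine Finset.prod_congr rfl fun x hx => ?_
    rw [Finset.mem_filter_univ] at hx
    simp [ltSign, hx]
  · intro x hx
    rw [apply_apply_of_mul_self hs]
    exact ltSign_mul_ltSign_swap σ hx.symm

/-- Under `σ * τ` the order of a pair changes first by `τ`, then by `σ` on the image pair, and `τ`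
carries the orbits of `s` to those of `τ * s * τ⁻¹`. This cocycle identity makes the action on
symmetric basis vectors multiplicative. -/
theorem pairSign_mul {s : Equiv.Perm α} (hs : s * s = 1) (σ τ : Equiv.Perm α) :
    pairSign s (σ * τ) = pairSign (τ * s * τ⁻¹) σ * pairSign s τ := by
  have hs' : τ * s * τ⁻¹ * (τ * s * τ⁻¹) = 1 := by
    rw [show τ * s * τ⁻¹ * (τ * s * τ⁻¹) = τ * (s * s) * τ⁻¹ by group, hs]
    group
  have hA := isTransversal_lt hs
  have hB : IsTransversal (τ * s * τ⁻¹) (Finset.map τ.toEmbedding {x | x < s x}) := by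
    refine ⟨fun x hx => ?_, fun x hx => ?_⟩
    · simp only [Finset.mem_map_equiv] at *
      simpa using! hA.1 _ hx
    · simp only [Finset.mem_map_equiv] at *
      have := hA.2 (τ.symm x) (fun e => hx (by
        simp only [Equiv.Perm.mul_apply]
        change τ (s (τ.symm x)) = x
        rw [e, Equiv.apply_symm_apply]))
      simpa using! this
  rw [pairSign_eq_prod hs hA, pairSign_eq_prod hs hA, pairSign_eq_prod hs' hB, Finset.prod_map,
    ← Finset.prod_mul_distrib]
  refine Finset.prod_congr rfl fun x _ => ?_
  have e : τ⁻¹ (τ x) = x := τ.symm_apply_apply x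
  simp only [Equiv.coe_toEmbedding, Equiv.Perm.mul_apply, e]
  linear_combination (-(ltSign x (s x) * ltSign (σ (τ x)) (σ (τ (s x))))) *
    ltSign_mul_self (τ x) (τ (s x))

/-- When `s` and `σ` commute, each factor has the form `f x * f (σ x)` with `f x = ltSign x (s x)`,
so products along a cycle of `σ` telescope. -/
theorem pairSign_of_commute {s σ : Equiv.Perm α} (hs : s * s = 1) (hc : s * σ = σ * s)
    {A : Finset α} (hA : IsTransversal s A) :
    pairSign s σ = ∏ x ∈ A, ltSign x (s x) * ltSign (σ x) (s (σ x)) := by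
  rw [pairSign_eq_prod hs hA]
  refine Finset.prod_congr rfl fun x _ => ?_
  rw [← Equiv.Perm.mul_apply s σ, hc, Equiv.Perm.mul_apply]

/-- On a `σ`-stable transversal, reindexing by `σ` identifies the products of `f x` and of `f (σ
x)`, and the total is a product of squares of signs. -/
theorem pairSign_eq_one {s σ : Equiv.Perm α} (hs : s * s = 1) (hc : s * σ = σ * s)
    {A : Finset α} (hA : IsTransversal s A) (hσ : ∀ x, σ x ∈ A ↔ x ∈ A) : pairSign s σ = 1 := by
  rw [pairSign_of_commute hs hc hA, Finset.prod_mul_distrib,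
    Finset.prod_equiv σ (t := A) (g := fun x => ltSign x (s x)) (fun x => (hσ x).symm)
      (fun _ _ => rfl), ← Finset.prod_mul_distrib]
  exact Finset.prod_eq_one fun x _ => ltSign_mul_self _ _

/-- Multiplying the involution `s`, which fixes the cycle of `x₀`, by the involution `t` that acts
on this cycle as a power of `σ` and trivially elsewhere changes the sign. -/
theorem pairSign_mul_of_fixed {s t σ : Equiv.Perm α} (hs : s * s = 1) (hc : s * σ = σ * s)
    (ht : t * t = 1) (htc : t * σ = σ * t) (hst : s * t = t * s) {x₀ : α} (hsx : s x₀ = x₀) {M : ℕ}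
    (hM : 0 < M) (hM' : Function.minimalPeriod σ x₀ = 2 * M) (htx : t x₀ = (σ ^ M) x₀)
    (htid : ∀ x, ¬ σ.SameCycle x₀ x → t x = x) : pairSign (s * t) σ = -pairSign s σ := by
  have hss : (s * t) * (s * t) = 1 := by
    rw [mul_assoc, ← mul_assoc t s t, ← hst, mul_assoc s t t, ht, mul_one, hs]
  have hsσ : (s * t) * σ = σ * (s * t) := by
    rw [mul_assoc, htc, ← mul_assoc, hc, mul_assoc]
  have hA := isTransversal_lt hs
  set A : Finset α := {x | x < s x}
  have hsc : ∀ i : ℕ, s ((σ ^ i) x₀) = (σ ^ i) x₀ := fun i => by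
    rw [perm_commute_pow_apply hc, hsx]
  have htc' : ∀ i : ℕ, t ((σ ^ i) x₀) = (σ ^ (i + M)) x₀ := fun i => by
    rw [perm_commute_pow_apply htc, htx, pow_add, Equiv.Perm.mul_apply]
  have hst' : ∀ i : ℕ, (s * t) ((σ ^ i) x₀) = (σ ^ (i + M)) x₀ := fun i => by
    rw [Equiv.Perm.mul_apply, htc', hsc]
  have hAc : ∀ x ∈ A, ¬ σ.SameCycle x₀ x := by
    intro x hx h
    obtain ⟨i, rfl⟩ := sameCycle_iff_exists_nat_pow.1 h
    exact hA.ne hx (hsc i)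
  have hinj : Set.InjOn (fun i : ℕ => (σ ^ i) x₀) (Finset.range (2 * M)) := by
    have := Function.iterate_injOn_Iio_minimalPeriod (f := σ) (x := x₀)
    rw [hM'] at this
    intro i hi j hj hij
    exact this (by simpa using hi) (by simpa using hj) (by simpa [← Equiv.Perm.coe_pow] using hij)
  have hper : ∀ i : ℕ, (σ ^ (i + 2 * M)) x₀ = (σ ^ i) x₀ := fun i => by
    rw [pow_add, Equiv.Perm.mul_apply, (perm_pow_apply_eq_iff_dvd σ (2 * M) x₀).2 (by rw [hM'])]
  have hinjM : Set.InjOn (fun i : ℕ => (σ ^ i) x₀) (Finset.range M) := by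
    refine hinj.mono fun i hi => ?_
    simp only [Finset.coe_range, Set.mem_Iio] at *
    omega
  -- The first half of the cycle of `x₀` represents the orbits that `t` adds; the remaining orbits
  -- of `s * t` are those of `s`.
  set B : Finset α := (Finset.range M).image fun i : ℕ => (σ ^ i) x₀ with hB
  have hBc : ∀ x ∈ B, σ.SameCycle x₀ x := by
    intro x hx
    obtain ⟨i, _, rfl⟩ := Finset.mem_image.1 hx
    exact sameCycle_iff_exists_nat_pow.2 ⟨i, rfl⟩
  have hcyc : ∀ x, σ.SameCycle x₀ x → x ∈ B ∨ ∃ i, i < M ∧ x = (σ ^ (i + M)) x₀ := by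
    intro x hx
    obtain ⟨i, rfl⟩ := sameCycle_iff_exists_nat_pow.1 hx
    have e : (σ ^ i) x₀ = (σ ^ (i % (2 * M))) x₀ := by
      rw [← hM', Equiv.Perm.coe_pow, Equiv.Perm.coe_pow, Function.iterate_mod_minimalPeriod_eq]
    have hlt : i % (2 * M) < 2 * M := Nat.mod_lt _ (by omega)
    rw [e]
    by_cases h : i % (2 * M) < M
    · exact Or.inl (Finset.mem_image.2 ⟨_, Finset.mem_range.2 h, rfl⟩)
    · exact Or.inr ⟨i % (2 * M) - M, by omega, by rw [Nat.sub_add_cancel (by omega)]⟩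
  have hnB : ∀ i, i < M → (σ ^ (i + M)) x₀ ∉ B := by
    intro i hi h
    obtain ⟨j, hj, e⟩ := Finset.mem_image.1 h
    rw [Finset.mem_range] at hj
    have := hinj (by simp; omega) (by simp; omega) e
    omega
  have hdisj : Disjoint A B := by
    rw [Finset.disjoint_left]
    exact fun x hxA hxB => hAc x hxA (hBc x hxB)
  have hoff : ∀ x, ¬ σ.SameCycle x₀ x → (s * t) x = s x := fun x hx => by
    rw [Equiv.Perm.mul_apply, htid x hx]
  have hscyc : ∀ x, σ.SameCycle x₀ x → σ.SameCycle x₀ (s x) := fun x hx => by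
    obtain ⟨i, rfl⟩ := sameCycle_iff_exists_nat_pow.1 hx
    rwa [hsc]
  have hAB : IsTransversal (s * t) (A ∪ B) := by
    refine ⟨fun x hx => ?_, fun x hx => ?_⟩
    · rcases Finset.mem_union.1 hx with hx | hx
      · rw [hoff x (hAc x hx), Finset.mem_union, not_or]
        refine ⟨hA.1 x hx, fun h => hAc x hx ?_⟩
        have := hscyc _ (hBc _ h)
        rwa [apply_apply_of_mul_self hs] at this
      · obtain ⟨i, hi, rfl⟩ := Finset.mem_image.1 hx
        rw [Finset.mem_range] at hi
        rw [hst', Finset.mem_union, not_or]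
        exact ⟨fun h => hAc _ h (sameCycle_iff_exists_nat_pow.2 ⟨_, rfl⟩), hnB i hi⟩
    · by_cases h : σ.SameCycle x₀ x
      · rcases hcyc x h with h | ⟨i, hi, rfl⟩
        · exact Or.inl (Finset.mem_union_right _ h)
        · right
          rw [hst', add_assoc, ← two_mul, hper]
          exact Finset.mem_union_right _ (Finset.mem_image.2 ⟨i, Finset.mem_range.2 hi, rfl⟩)
      · rw [hoff x h] at hx ⊢
        exact (hA.2 x hx).imp (Finset.mem_union_left _) (Finset.mem_union_left _)
  rw [pairSign_of_commute hss hsσ hAB, pairSign_of_commute hs hc hA, Finset.prod_union hdisj,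
    hB, Finset.prod_image hinjM, ← mul_neg_one]
  congr 1
  · refine Finset.prod_congr rfl fun x hx => ?_
    rw [hoff x (hAc x hx), hoff (σ x) (fun h => hAc x hx (Equiv.Perm.sameCycle_apply_right.1 h))]
  -- Along the half cycle the product telescopes to its two end signs. These compare `x₀` with `σ ^
  -- M x₀` in the two opposite orders, and so contribute `-1`.
  · have e := prod_range_mul_succ (fun i => ltSign ((σ ^ i) x₀) ((s * t) ((σ ^ i) x₀)))
      (fun i => ltSign_mul_self _ _) M
    simp only [pow_succ', Equiv.Perm.mul_apply] at e ⊢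
    rw [e, pow_zero, Equiv.Perm.one_apply, htx, hsc, htc', ← two_mul, hsc]
    have h2 := hper 0
    rw [zero_add, pow_zero, Equiv.Perm.one_apply] at h2
    have hne : x₀ ≠ (σ ^ M) x₀ := fun h => by
      have := (perm_pow_apply_eq_iff_dvd σ M x₀).1 h.symm
      rw [hM'] at this
      have := Nat.le_of_dvd hM this
      omega
    rw [h2, ltSign_swap hne, mul_neg, ltSign_mul_self]

end PairSign

/-! ### Involutions and square roots commuting with a permutation: the fibres that cancel -/

section SquareRoots

variable {α : Type*}

/-- A chosen element of the cycle of `x`. -/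
noncomputable def cycleRep (σ : Equiv.Perm α) (x : α) : α :=
  (Quotient.mk (Equiv.Perm.SameCycle.setoid σ) x).out

theorem cycleRep_eq_iff {σ : Equiv.Perm α} {x y : α} :
    cycleRep σ x = cycleRep σ y ↔ σ.SameCycle x y := by
  unfold cycleRep
  rw [Quotient.out_inj, Quotient.eq]
  rfl

theorem sameCycle_cycleRep (σ : Equiv.Perm α) (x : α) : σ.SameCycle (cycleRep σ x) x :=
  Quotient.exact (Quotient.out_eq (Quotient.mk (Equiv.Perm.SameCycle.setoid σ) x))

theorem cycleRep_apply (σ : Equiv.Perm α) (x : α) : cycleRep σ (σ x) = cycleRep σ x :=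
  cycleRep_eq_iff.2 (Equiv.Perm.sameCycle_apply_left.2 (Equiv.Perm.SameCycle.refl _ _))

theorem cycleRep_pow_apply [Finite α] (σ : Equiv.Perm α) (i : ℕ) (x : α) :
    cycleRep σ ((σ ^ i) x) = cycleRep σ x :=
  cycleRep_eq_iff.2 (sameCycle_iff_exists_nat_pow.2 ⟨i, rfl⟩).symm

theorem Equiv.Perm.SameCycle.apply_commute [Finite α] {σ s : Equiv.Perm α} (hc : s * σ = σ * s) {x y : α}
    (h : σ.SameCycle x y) : σ.SameCycle (s x) (s y) := by
  obtain ⟨i, rfl⟩ := sameCycle_iff_exists_nat_pow.1 h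
  exact sameCycle_iff_exists_nat_pow.2 ⟨i, (perm_commute_pow_apply hc i x).symm⟩

/-- On a cycle that it preserves, a map commuting with `σ` is a power `σ ^ i`; being an involution
forces `2 * M ∣ 2 * i`, so `i` is an even or an odd multiple of `M`. -/
theorem eq_or_eq_half_of_sameCycle [Finite α] {s σ : Equiv.Perm α} (hs : s * s = 1) (hc : s * σ = σ * s)
    {x₀ : α} {M : ℕ} (hM : Function.minimalPeriod σ x₀ = 2 * M)
    (h : σ.SameCycle x₀ (s x₀)) : s x₀ = x₀ ∨ s x₀ = (σ ^ M) x₀ := by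
  obtain ⟨i, hi⟩ := sameCycle_iff_exists_nat_pow.1 h
  have h2 : (σ ^ (i + i)) x₀ = x₀ := by
    rw [pow_add, Equiv.Perm.mul_apply, hi, ← perm_commute_pow_apply hc, hi,
      apply_apply_of_mul_self hs]
  rw [perm_pow_apply_eq_iff_dvd, hM, ← two_mul] at h2
  obtain ⟨u, rfl⟩ := Nat.dvd_of_mul_dvd_mul_left two_pos h2
  have hfull : ∀ v, (σ ^ (2 * M * v)) x₀ = x₀ := fun v => by
    rw [perm_pow_apply_eq_iff_dvd, hM]
    exact dvd_mul_right _ _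
  rcases Nat.even_or_odd' u with ⟨v, rfl | rfl⟩
  · left
    rw [← hi, show M * (2 * v) = 2 * M * v by ring, hfull]
  · right
    rw [← hi, show M * (2 * v + 1) = M + 2 * M * v by ring, pow_add, Equiv.Perm.mul_apply, hfull]

/-- If `κ = σ ^ j` has even period at `x₀`, then so has `σ`, and the half-turn of the cycle of `x₀`
is a power of `κ`. -/
theorem exists_half_period [Finite α] {σ κ : Equiv.Perm α} {j : ℕ} (hκ : κ = σ ^ j) {x₀ : α}
    (hodd : ∀ N, Odd N → (κ ^ N) x₀ ≠ x₀) :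
    ∃ M m, 0 < M ∧ Function.minimalPeriod σ x₀ = 2 * M ∧ (σ ^ M) x₀ = (κ ^ m) x₀ := by
  have hpos : 0 < Function.minimalPeriod κ x₀ :=
    Function.IsPeriodicPt.minimalPeriod_pos (orderOf_pos κ) (by
      change (κ^[orderOf κ]) x₀ = x₀
      rw [← Equiv.Perm.coe_pow, pow_orderOf_eq_one, Equiv.Perm.one_apply])
  rcases Nat.even_or_odd' (Function.minimalPeriod κ x₀) with ⟨m, hm | hm⟩
  swap
  · exact absurd ((perm_pow_apply_eq_iff_dvd κ _ x₀).2 dvd_rfl) (hodd _ ⟨m, hm⟩)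
  -- The `σ`-period of `x₀` divides `2 * (j * m)` but not `j * m`. It is therefore even, and `j * m`
  -- is an odd multiple of its half `M`.
  have h1 : ¬ Function.minimalPeriod σ x₀ ∣ j * m := by
    rw [← perm_pow_apply_eq_iff_dvd, pow_mul, ← hκ, perm_pow_apply_eq_iff_dvd, hm]
    intro h
    have := Nat.le_of_dvd (by omega) h
    omega
  have h2 : Function.minimalPeriod σ x₀ ∣ 2 * (j * m) := by
    rw [← perm_pow_apply_eq_iff_dvd, show 2 * (j * m) = j * (2 * m) by ring, pow_mul, ← hκ,
      perm_pow_apply_eq_iff_dvd, hm]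
  have hposσ : 0 < Function.minimalPeriod σ x₀ :=
    Nat.pos_of_ne_zero fun h => h1 (by rw [h] at h2 ⊢; simpa using h2)
  have he : Even (Function.minimalPeriod σ x₀) := by
    by_contra ho
    exact h1 ((Nat.Coprime.dvd_of_dvd_mul_left
      (Nat.coprime_two_right.2 (Nat.not_even_iff_odd.1 ho))) h2)
  obtain ⟨M, hM⟩ := he
  rw [← two_mul] at hM
  rw [hM] at h1 h2 hposσ
  obtain ⟨u, hu⟩ := Nat.dvd_of_mul_dvd_mul_left two_pos h2
  refine ⟨M, m, by omega, hM, ?_⟩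
  rw [hκ, ← pow_mul, hu]
  rcases Nat.even_or_odd' u with ⟨v, rfl | rfl⟩
  · exact absurd ⟨v, by rw [hu]; ring⟩ h1
  · rw [show M * (2 * v + 1) = M + 2 * M * v by ring, pow_add, Equiv.Perm.mul_apply,
      (perm_pow_apply_eq_iff_dvd σ (2 * M * v) x₀).2 (by rw [hM]; exact dvd_mul_right _ _)]

variable [Fintype α] [LinearOrder α]

/-- The half-turn of a cycle of even length `2 * M`, extended by the identity, is an involution that
commutes with `σ`. -/
theorem halfCycle_spec {σ : Equiv.Perm α} {x₀ : α} {M : ℕ}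
    (hM : Function.minimalPeriod σ x₀ = 2 * M) :
    ((σ.cycleOf x₀) ^ M * (σ.cycleOf x₀) ^ M = 1) ∧
    ((σ.cycleOf x₀) ^ M) * σ = σ * ((σ.cycleOf x₀) ^ M) ∧
    (∀ x, σ.SameCycle x₀ x → ((σ.cycleOf x₀) ^ M) x = (σ ^ M) x) ∧
    (∀ x, ¬ σ.SameCycle x₀ x → ((σ.cycleOf x₀) ^ M) x = x) := by
  have hpow : ∀ (i : ℕ) x, σ.SameCycle x₀ x → ((σ.cycleOf x₀) ^ i) x = (σ ^ i) x := by
    intro i x hx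
    rw [hx.cycleOf_eq, Equiv.Perm.cycleOf_pow_apply_self]
  have hid : ∀ (i : ℕ) x, ¬ σ.SameCycle x₀ x → ((σ.cycleOf x₀) ^ i) x = x := by
    intro i x hx
    have : (σ.cycleOf x₀) x = x := Equiv.Perm.cycleOf_apply_of_not_sameCycle hx
    rw [Equiv.Perm.coe_pow]
    exact Function.iterate_fixed this i
  refine ⟨?_, ?_, hpow M, hid M⟩
  · ext x
    rw [← pow_add, ← two_mul, Equiv.Perm.one_apply]
    by_cases hx : σ.SameCycle x₀ x
    · rw [hpow _ _ hx]
      obtain ⟨i, rfl⟩ := sameCycle_iff_exists_nat_pow.1 hx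
      rw [← Equiv.Perm.mul_apply, ← pow_add, add_comm, pow_add, Equiv.Perm.mul_apply,
        (perm_pow_apply_eq_iff_dvd σ _ x₀).2 hM.dvd]
    · exact hid _ _ hx
  · ext x
    rw [Equiv.Perm.mul_apply, Equiv.Perm.mul_apply]
    by_cases hx : σ.SameCycle x₀ x
    · rw [hpow _ _ hx, hpow _ _ (Equiv.Perm.sameCycle_apply_right.2 hx),
        ← Equiv.Perm.mul_apply, ← Equiv.Perm.mul_apply, pow_mul_comm']
    · rw [hid _ _ hx, hid _ _ (fun h => hx (Equiv.Perm.sameCycle_apply_right.1 h))]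

/-- The involutions that commute with `σ` and preserve `z`. -/
def commInvolutions {A : Type*} [DecidableEq A] (σ : Equiv.Perm α) (z : α → A) :
    Finset (Equiv.Perm α) :=
  {s | s * s = 1 ∧ s * σ = σ * s ∧ ∀ x, z (s x) = z x}

/-- The square roots of `κ` that commute with `σ` and preserve `z`. -/
def commRoots {A : Type*} [DecidableEq A] (σ κ : Equiv.Perm α) (z : α → A) :
    Finset (Equiv.Perm α) :=
  {τ | τ * τ = κ ∧ τ * σ = σ * τ ∧ ∀ x, z (τ x) = z x}

variable {A : Type*} [DecidableEq A] {σ κ : Equiv.Perm α} {z : α → A} {k : α → α}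

theorem mem_commInvolutions {s : Equiv.Perm α} :
    s ∈ commInvolutions σ z ↔ s * s = 1 ∧ s * σ = σ * s ∧ ∀ x, z (s x) = z x :=
  Finset.mem_filter_univ s

theorem mem_commRoots {τ : Equiv.Perm α} :
    τ ∈ commRoots σ κ z ↔ τ * τ = κ ∧ τ * σ = σ * τ ∧ ∀ x, z (τ x) = z x :=
  Finset.mem_filter_univ τ

/-- The half-turn `t` of the cycle of `x₀` agrees there with a power of `κ`, hence preserves `z`.
The map `s ↦ s * t` stays inside the fibre and reverses the sign. -/
theorem sum_pairSign_eq_zero {j : ℕ} (hκ : κ = σ ^ j) (hz : ∀ x, z (κ x) = z x) {x₀ : α}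
    (hk : k x₀ = cycleRep σ x₀) (hodd : ∀ N, Odd N → (κ ^ N) x₀ ≠ x₀) :
    ∑ s ∈ commInvolutions σ z with (fun x => cycleRep σ (s x)) = k, pairSign s σ = 0 := by
  obtain ⟨M, m, hM0, hM, hMm⟩ := exists_half_period hκ hodd
  obtain ⟨htt, htσ, htc, hto⟩ := halfCycle_spec hM
  set t := (σ.cycleOf x₀) ^ M with ht
  have hzpow : ∀ (i : ℕ) x, z ((κ ^ i) x) = z x := by
    intro i x
    induction i with
    | zero => rfl
    | succ i ih => rw [pow_succ', Equiv.Perm.mul_apply, hz, ih]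
  have htz : ∀ x, z (t x) = z x := by
    intro x
    by_cases hx : σ.SameCycle x₀ x
    · rw [htc x hx]
      obtain ⟨i, rfl⟩ := sameCycle_iff_exists_nat_pow.1 hx
      rw [← Equiv.Perm.mul_apply, ← pow_add, add_comm, pow_add, Equiv.Perm.mul_apply, hMm, hκ,
        ← Equiv.Perm.mul_apply, ← pow_mul, ← pow_add, add_comm, pow_add, pow_mul, ← hκ,
        Equiv.Perm.mul_apply, hzpow]
    · rw [hto x hx]
  have hcyc : ∀ s ∈ commInvolutions σ z, (fun x => cycleRep σ (s x)) = k →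
      σ.SameCycle x₀ (s x₀) := by
    intro s _ e
    rw [← cycleRep_eq_iff, ← hk, ← e]
  have hst : ∀ s ∈ commInvolutions σ z, (fun x => cycleRep σ (s x)) = k → s * t = t * s := by
    intro s hs e
    have h1 := hcyc s hs e
    simp only [commInvolutions, Finset.mem_filter_univ] at hs
    obtain ⟨hs1, hs2, -⟩ := hs
    ext x
    rw [Equiv.Perm.mul_apply, Equiv.Perm.mul_apply]
    by_cases hx : σ.SameCycle x₀ x
    · rw [htc x hx, htc (s x) (h1.trans (hx.apply_commute hs2)), perm_commute_pow_apply hs2]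
    · rw [hto x hx, hto (s x)]
      intro h
      have := h.apply_commute hs2
      rw [apply_apply_of_mul_self hs1] at this
      exact hx (h1.trans this)
  have hmem : ∀ s ∈ (commInvolutions σ z).filter (fun s => (fun x => cycleRep σ (s x)) = k),
      s * t ∈ (commInvolutions σ z).filter (fun s => (fun x => cycleRep σ (s x)) = k) := by
    intro s hs
    obtain ⟨hs, e⟩ := Finset.mem_filter.1 hs
    have h2 := hst s hs e
    have hs' := hs
    simp only [commInvolutions, Finset.mem_filter_univ] at hs
    obtain ⟨hs1, hs2, hs3⟩ := hs
    refine Finset.mem_filter.2 ⟨Finset.mem_filter_univ _ |>.2 ⟨?_, ?_, fun x => ?_⟩, ?_⟩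
    · rw [mul_assoc, ← mul_assoc t s t, ← h2, mul_assoc s t t, htt, mul_one, hs1]
    · rw [mul_assoc, htσ, ← mul_assoc, hs2, mul_assoc]
    · rw [Equiv.Perm.mul_apply, hs3, htz]
    · rw [← e]
      ext x
      rw [cycleRep_eq_iff, Equiv.Perm.mul_apply]
      refine Equiv.Perm.SameCycle.apply_commute hs2 ?_
      by_cases hx : σ.SameCycle x₀ x
      · rw [htc x hx]
        exact (sameCycle_iff_exists_nat_pow.2 ⟨M, rfl⟩).symm
      · rw [hto x hx]
  have hneg : ∀ s ∈ (commInvolutions σ z).filter (fun s => (fun x => cycleRep σ (s x)) = k),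
      s x₀ = x₀ → pairSign (s * t) σ = -pairSign s σ := by
    intro s hs hfix
    obtain ⟨hs, e⟩ := Finset.mem_filter.1 hs
    have h2 := hst s hs e
    simp only [commInvolutions, Finset.mem_filter_univ] at hs
    exact pairSign_mul_of_fixed hs.1 hs.2.1 htt htσ h2 hfix hM0 hM
      (htc x₀ (Equiv.Perm.SameCycle.refl _ _)) hto
  have hneg' : ∀ s ∈ (commInvolutions σ z).filter (fun s => (fun x => cycleRep σ (s x)) = k),
      pairSign (s * t) σ = -pairSign s σ := by
    intro s hs
    have hs0 := hs
    obtain ⟨hs, e⟩ := Finset.mem_filter.1 hs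
    have h1 := hcyc s hs e
    have h2 := hst s hs e
    simp only [commInvolutions, Finset.mem_filter_univ] at hs
    -- At `x₀`, `s` is either trivial or the half-turn. In the second case `s * t` is trivial there,
    -- and the first case applied to it gives the same sign relation.
    rcases eq_or_eq_half_of_sameCycle hs.1 hs.2.1 hM h1 with h | h
    · exact hneg s hs0 h
    · have := hneg _ (hmem s hs0) (by
        rw [h2, Equiv.Perm.mul_apply, h, ← htc x₀ (Equiv.Perm.SameCycle.refl _ _),
          apply_apply_of_mul_self htt])
      rw [mul_assoc, htt, mul_one] at this
      rw [this, neg_neg]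
  have hsum : ∑ s ∈ commInvolutions σ z with (fun x => cycleRep σ (s x)) = k, pairSign s σ
      = ∑ s ∈ commInvolutions σ z with (fun x => cycleRep σ (s x)) = k, pairSign (s * t) σ :=
    Finset.sum_bij' (fun s _ => s * t) (fun s _ => s * t) hmem hmem
      (fun s _ => by rw [mul_assoc, htt, mul_one]) (fun s _ => by rw [mul_assoc, htt, mul_one])
      (fun s _ => by rw [mul_assoc, htt, mul_one])
  rw [Finset.sum_congr rfl hneg', Finset.sum_neg_distrib] at hsum
  exact self_eq_neg.1 hsum

/-- A square root preserving the cycle of `x₀` and the colours acts at `x₀` as some `κ ^ l`. Then `κ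
^ (2 * l)` and `κ` agree at `x₀`, which gives `κ` an odd period there. -/
theorem commRoots_filter_eq_empty
    (hz' : ∀ x (i : ℕ), z ((σ ^ i) x) = z x → ∃ l : ℕ, (σ ^ i) x = (κ ^ l) x) {x₀ : α}
    (hk : k x₀ = cycleRep σ x₀) (hodd : ∀ N, Odd N → (κ ^ N) x₀ ≠ x₀) :
    (commRoots σ κ z).filter (fun τ => (fun x => cycleRep σ (τ x)) = k) = ∅ := by
  rw [Finset.filter_eq_empty_iff]
  intro τ hτ e
  simp only [commRoots, Finset.mem_filter_univ] at hτ
  obtain ⟨h1, h2, h3⟩ := hτ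
  have hc : cycleRep σ x₀ = cycleRep σ (τ x₀) := by rw [← hk, ← e]
  obtain ⟨i, hi⟩ := sameCycle_iff_exists_nat_pow.1 (cycleRep_eq_iff.1 hc)
  obtain ⟨l, hl⟩ := hz' x₀ i (by rw [hi, h3])
  have hκ : τ * κ = κ * τ := by rw [← h1, mul_assoc]
  have h4 : (κ ^ (l + l)) x₀ = κ x₀ := by
    rw [pow_add, Equiv.Perm.mul_apply, ← hl, hi, ← perm_commute_pow_apply hκ, ← hl, hi,
      ← Equiv.Perm.mul_apply, h1]
  rcases l with _ | l
  · exact hodd 1 odd_one (by simpa using h4.symm)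
  · refine hodd (2 * l + 1) ⟨l, rfl⟩ (κ.injective ?_)
    rw [← h4, ← Equiv.Perm.mul_apply, ← pow_succ']
    congr 2
    ring

end SquareRoots

/-! ### The fibres with odd periods, where involutions and square roots correspond -/

section SquareRootsOdd

variable {α : Type*}

theorem perm_pow_apply_of_two_mul {κ : Equiv.Perm α} {x : α} {N : ℕ} (hN : Odd N) (h : (κ ^ N) x = x) {i : ℕ}
    (hi : (κ ^ (2 * i)) x = x) : (κ ^ i) x = x := by
  rw [perm_pow_apply_eq_iff_dvd] at *
  exact ((Nat.coprime_two_right.2 (hN.of_dvd_nat h))).dvd_of_dvd_mul_left hi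

theorem commute_of_eq_pow {s σ κ : Equiv.Perm α} {j : ℕ} (hκ : κ = σ ^ j) (hc : s * σ = σ * s) :
    s * κ = κ * s := by
  rw [hκ]
  exact (show Commute s σ from hc).pow_right j

variable [Fintype α] [LinearOrder α]
variable {A : Type*} [DecidableEq A] {σ κ : Equiv.Perm α} {z : α → A} {k : α → α}

/-- The product of the minimal periods serves all preserved cycles at once, so that the single
exponent `e + 1` gives a square root of `κ` on each of them. -/
theorem exists_uniform_odd_period
    (hodd : ∀ x, k x = cycleRep σ x → ∃ N, Odd N ∧ (κ ^ N) x = x) :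
    ∃ e : ℕ, ∀ x, k x = cycleRep σ x → (κ ^ (2 * e + 1)) x = x := by
  have h : Odd (∏ x with k x = cycleRep σ x, Function.minimalPeriod κ x) := by
    refine Finset.prod_induction _ Odd (fun _ _ => Odd.mul) odd_one fun x hx => ?_
    obtain ⟨N, hN, hN'⟩ := hodd x ((Finset.mem_filter_univ x).1 hx)
    exact hN.of_dvd_nat ((perm_pow_apply_eq_iff_dvd κ N x).1 hN')
  obtain ⟨e, he⟩ := h
  refine ⟨e, fun x hx => ?_⟩
  rw [perm_pow_apply_eq_iff_dvd, ← he]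
  exact Finset.dvd_prod_of_mem _ ((Finset.mem_filter_univ x).2 hx)

/-- On a preserved cycle `s` is a power of `σ` that respects `z`, hence locally a power of `κ`, and
the powers of `κ` on an orbit of odd length contain no element of order two. -/
theorem apply_eq_self_of_odd
    (hz' : ∀ x (i : ℕ), z ((σ ^ i) x) = z x → ∃ l : ℕ, (σ ^ i) x = (κ ^ l) x)
    {j : ℕ} (hκ : κ = σ ^ j) {s : Equiv.Perm α} (hs : s ∈ commInvolutions σ z) {x : α}
    (hx : cycleRep σ (s x) = cycleRep σ x) {e : ℕ} (he : (κ ^ (2 * e + 1)) x = x) : s x = x := by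
  simp only [commInvolutions, Finset.mem_filter_univ] at hs
  obtain ⟨hs1, hs2, hs3⟩ := hs
  obtain ⟨i, hi⟩ := sameCycle_iff_exists_nat_pow.1 (cycleRep_eq_iff.1 hx).symm
  obtain ⟨l, hl⟩ := hz' x i (by rw [hi, hs3])
  rw [← hi, hl]
  refine perm_pow_apply_of_two_mul ⟨e, rfl⟩ he ?_
  rw [two_mul, pow_add, Equiv.Perm.mul_apply, ← hl, hi,
    ← perm_commute_pow_apply (commute_of_eq_pow hκ hs2), ← hl, hi, apply_apply_of_mul_self hs1]

/-- In a cyclic group of odd order square roots are unique; when `κ ^ (2 * e + 1)` is trivial, the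
square root of `κ` is `κ ^ (e + 1)`. -/
theorem apply_eq_pow_of_odd
    (hz' : ∀ x (i : ℕ), z ((σ ^ i) x) = z x → ∃ l : ℕ, (σ ^ i) x = (κ ^ l) x)
    {j : ℕ} (hκ : κ = σ ^ j) {τ : Equiv.Perm α} (hτ : τ ∈ commRoots σ κ z) {x : α}
    (hx : cycleRep σ (τ x) = cycleRep σ x) {e : ℕ} (he : (κ ^ (2 * e + 1)) x = x) :
    τ x = (κ ^ (e + 1)) x := by
  simp only [commRoots, Finset.mem_filter_univ] at hτ
  obtain ⟨h1, h2, h3⟩ := hτ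
  obtain ⟨i, hi⟩ := sameCycle_iff_exists_nat_pow.1 (cycleRep_eq_iff.1 hx).symm
  obtain ⟨l, hl⟩ := hz' x i (by rw [hi, h3])
  have h4 : (κ ^ (l + l)) x = κ x := by
    rw [pow_add, Equiv.Perm.mul_apply, ← hl, hi,
      ← perm_commute_pow_apply (commute_of_eq_pow hκ h2), ← hl, hi, ← Equiv.Perm.mul_apply, h1]
  rw [← hi, hl]
  apply (κ ^ e).injective
  rw [← Equiv.Perm.mul_apply, ← Equiv.Perm.mul_apply, ← pow_add, ← pow_add,
    show e + (e + 1) = 2 * e + 1 by ring, he]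
  refine perm_pow_apply_of_two_mul ⟨e, rfl⟩ he ?_
  rw [show 2 * (e + l) = 2 * e + (l + l) by ring, pow_add, Equiv.Perm.mul_apply, h4,
    ← Equiv.Perm.mul_apply, ← pow_succ, he]

/-- On two cycles exchanged by `s`, going up by `s` and back down by `κ ∘ s` composes to `κ` from
either side; the order of the representatives decides which direction is up. On preserved cycles the
unique root `κ ^ (e + 1)` is used. -/
theorem exists_commRoot {j : ℕ} (hκ : κ = σ ^ j) (hz : ∀ x, z (κ x) = z x) {e : ℕ}
    (he : ∀ x, k x = cycleRep σ x → (κ ^ (2 * e + 1)) x = x) {s : Equiv.Perm α}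
    (hs : s ∈ (commInvolutions σ z).filter (fun s => (fun x => cycleRep σ (s x)) = k)) :
    ∃ τ ∈ (commRoots σ κ z).filter (fun τ => (fun x => cycleRep σ (τ x)) = k),
      ∀ x, τ x = if k x = cycleRep σ x then (κ ^ (e + 1)) x else
        if cycleRep σ x < k x then s x else κ (s x) := by
  rw [Finset.mem_filter] at hs
  obtain ⟨hs, rfl⟩ := hs
  simp only [commInvolutions, Finset.mem_filter_univ] at hs
  obtain ⟨hs1, hs2, hs3⟩ := hs
  have hsκ := commute_of_eq_pow hκ hs2
  have hss := apply_apply_of_mul_self hs1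
  have hqκ : ∀ x, cycleRep σ (κ x) = cycleRep σ x := fun x => by
    rw [hκ, cycleRep_pow_apply]
  have hqκ' : ∀ i x, cycleRep σ ((κ ^ i) x) = cycleRep σ x := fun i x => by
    rw [hκ, ← pow_mul, cycleRep_pow_apply]
  have hqs : ∀ {x y}, cycleRep σ x = cycleRep σ y → cycleRep σ (s x) = cycleRep σ (s y) :=
    fun h => cycleRep_eq_iff.2 ((cycleRep_eq_iff.1 h).apply_commute hs2)
  set Φ : α → α := fun x => if cycleRep σ (s x) = cycleRep σ x then (κ ^ (e + 1)) x else
    if cycleRep σ x < cycleRep σ (s x) then s x else κ (s x) with hΦ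
  have h1 : ∀ x, cycleRep σ (Φ x) = cycleRep σ (s x) := by
    intro x
    simp only [hΦ]
    split_ifs with h h'
    · rw [hqκ', h]
    · rfl
    · exact hqκ _
  have h2 : ∀ x, cycleRep σ (s (Φ x)) = cycleRep σ x := fun x => by
    rw [hqs (h1 x), hss]
  have hzpow : ∀ (i : ℕ) x, z ((κ ^ i) x) = z x := by
    intro i x
    induction i with
    | zero => rfl
    | succ i ih => rw [pow_succ', Equiv.Perm.mul_apply, hz, ih]
  have hΦΦ : ∀ x, Φ (Φ x) = κ x := by
    intro x
    have e1 : Φ (Φ x) = if cycleRep σ x = cycleRep σ (s x) then (κ ^ (e + 1)) (Φ x) else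
      if cycleRep σ (s x) < cycleRep σ x then s (Φ x) else κ (s (Φ x)) := by
      conv_lhs => rw [hΦ]
      simp only
      rw [h1, h2]
    rw [e1]
    rcases lt_trichotomy (cycleRep σ x) (cycleRep σ (s x)) with h | h | h
    · rw [if_neg h.ne, if_neg h.not_gt]
      simp [hΦ, h.ne', h, hss]
    · rw [if_pos h]
      simp only [hΦ, h, if_true]
      rw [← Equiv.Perm.mul_apply, ← pow_add, show e + 1 + (e + 1) = 1 + (2 * e + 1) by ring,
        pow_add, Equiv.Perm.mul_apply, he x h.symm, pow_one]
    · rw [if_neg h.ne', if_pos h]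
      simp only [hΦ, h.ne, if_false, h.not_gt]
      rw [perm_commute_apply hsκ, hss]
  have hinj : Function.Injective Φ := fun x y hxy => κ.injective (by rw [← hΦΦ, ← hΦΦ, hxy])
  refine ⟨Equiv.ofBijective Φ (Finite.injective_iff_bijective.1 hinj), ?_, fun x => rfl⟩
  refine Finset.mem_filter.2 ⟨(Finset.mem_filter_univ _).2 ⟨?_, ?_, fun x => ?_⟩, funext h1⟩
  · ext x
    exact hΦΦ x
  · ext x
    change Φ (σ x) = σ (Φ x)
    simp only [hΦ]
    rw [perm_commute_apply hs2, cycleRep_apply, cycleRep_apply]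
    have hκσ : κ * σ = σ * κ := (commute_of_eq_pow hκ rfl).symm
    have hκσ' : κ ^ (e + 1) * σ = σ * κ ^ (e + 1) :=
      (show Commute κ σ from hκσ).pow_left _
    split_ifs
    · exact perm_commute_apply hκσ' x
    · rfl
    · exact perm_commute_apply hκσ _
  · change z (Φ x) = z x
    simp only [hΦ]
    split_ifs
    · exact hzpow _ _
    · exact hs3 x
    · rw [hz, hs3]

/-- The inverse recipe: the factor `κ` is removed from the downward direction, and the map becomes
trivial on preserved cycles. -/
theorem exists_commInvolution {j : ℕ} (hκ : κ = σ ^ j) (hz : ∀ x, z (κ x) = z x)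
    {τ : Equiv.Perm α}
    (hτ : τ ∈ (commRoots σ κ z).filter (fun τ => (fun x => cycleRep σ (τ x)) = k)) :
    ∃ s ∈ (commInvolutions σ z).filter (fun s => (fun x => cycleRep σ (s x)) = k),
      ∀ x, s x = if k x = cycleRep σ x then x else
        if cycleRep σ x < k x then τ x else κ⁻¹ (τ x) := by
  rw [Finset.mem_filter] at hτ
  obtain ⟨hτ, rfl⟩ := hτ
  simp only [commRoots, Finset.mem_filter_univ] at hτ
  obtain ⟨hτ1, hτ2, hτ3⟩ := hτ
  have hτκ := commute_of_eq_pow hκ hτ2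
  have hκτ : τ * κ⁻¹ = κ⁻¹ * τ := (show Commute τ κ from hτκ).inv_right
  have hκi : ∀ x, κ (κ⁻¹ x) = x := fun x => κ.apply_symm_apply x
  have hκi' : ∀ x, κ⁻¹ (κ x) = x := fun x => κ.symm_apply_apply x
  have hττ : ∀ x, τ (τ x) = κ x := fun x => by rw [← Equiv.Perm.mul_apply, hτ1]
  have hqκ : ∀ x, cycleRep σ (κ x) = cycleRep σ x := fun x => by
    rw [hκ, cycleRep_pow_apply]
  have hqτ : ∀ {x y}, cycleRep σ x = cycleRep σ y → cycleRep σ (τ x) = cycleRep σ (τ y) :=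
    fun h => cycleRep_eq_iff.2 ((cycleRep_eq_iff.1 h).apply_commute hτ2)
  set Ψ : α → α := fun x => if cycleRep σ (τ x) = cycleRep σ x then x else
    if cycleRep σ x < cycleRep σ (τ x) then τ x else κ⁻¹ (τ x) with hΨ
  have h1 : ∀ x, cycleRep σ (Ψ x) = cycleRep σ (τ x) := by
    intro x
    simp only [hΨ]
    split_ifs with h h'
    · exact h.symm
    · rfl
    · rw [← hqκ, hκi]
  have h2 : ∀ x, cycleRep σ (τ (Ψ x)) = cycleRep σ x := fun x => by
    rw [hqτ (h1 x), hττ, hqκ]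
  have hΨΨ : ∀ x, Ψ (Ψ x) = x := by
    intro x
    have e1 : Ψ (Ψ x) = if cycleRep σ x = cycleRep σ (τ x) then Ψ x else
      if cycleRep σ (τ x) < cycleRep σ x then τ (Ψ x) else κ⁻¹ (τ (Ψ x)) := by
      conv_lhs => rw [hΨ]
      simp only
      rw [h1, h2]
    rw [e1]
    rcases lt_trichotomy (cycleRep σ x) (cycleRep σ (τ x)) with h | h | h
    · rw [if_neg h.ne, if_neg h.not_gt]
      simp [hΨ, h.ne', h, hττ]
    · rw [if_pos h]
      simp only [hΨ, h, if_true]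
    · rw [if_neg h.ne', if_pos h]
      simp only [hΨ, h.ne, if_false, h.not_gt]
      rw [perm_commute_apply hκτ, hττ, hκi']
  refine ⟨Function.Involutive.toPerm Ψ hΨΨ, ?_, fun x => rfl⟩
  refine Finset.mem_filter.2 ⟨(Finset.mem_filter_univ _).2 ⟨?_, ?_, fun x => ?_⟩, funext h1⟩
  · ext x
    exact hΨΨ x
  · ext x
    change Ψ (σ x) = σ (Ψ x)
    simp only [hΨ]
    rw [perm_commute_apply hτ2, cycleRep_apply, cycleRep_apply]
    have hκσ : κ⁻¹ * σ = σ * κ⁻¹ :=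
      (show Commute κ σ from (commute_of_eq_pow hκ rfl).symm).inv_left
    split_ifs
    · rfl
    · rfl
    · exact perm_commute_apply hκσ _
  · change z (Ψ x) = z x
    simp only [hΨ]
    split_ifs
    · rfl
    · exact hτ3 x
    · rw [← hz, hκi, hτ3]

theorem sum_pairSign_eq_card_of_odd {j : ℕ} (hκ : κ = σ ^ j) (hz : ∀ x, z (κ x) = z x)
    (hz' : ∀ x (i : ℕ), z ((σ ^ i) x) = z x → ∃ l : ℕ, (σ ^ i) x = (κ ^ l) x)
    (hodd : ∀ x, k x = cycleRep σ x → ∃ N, Odd N ∧ (κ ^ N) x = x) :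
    ∑ s ∈ commInvolutions σ z with (fun x => cycleRep σ (s x)) = k, pairSign s σ =
      ((commRoots σ κ z).filter (fun τ => (fun x => cycleRep σ (τ x)) = k)).card := by
  obtain ⟨e, he⟩ := exists_uniform_odd_period hodd
  have hsign : ∀ s ∈ (commInvolutions σ z).filter (fun s => (fun x => cycleRep σ (s x)) = k),
      pairSign s σ = 1 := by
    intro s hs
    obtain ⟨hs, e'⟩ := Finset.mem_filter.1 hs
    have hfix : ∀ x, cycleRep σ (s x) = cycleRep σ x → s x = x := fun x hx =>
      apply_eq_self_of_odd hz' hκ hs hx (he x (by rw [← e']; exact hx))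
    simp only [commInvolutions, Finset.mem_filter_univ] at hs
    obtain ⟨hs1, hs2, -⟩ := hs
    -- Only exchanged cycles contribute, and taking the lower cycle of each pair gives a transversal
    -- made of whole cycles, which is `σ`-stable.
    refine pairSign_eq_one hs1 hs2 (A := {x | cycleRep σ x < cycleRep σ (s x)})
      ⟨fun x hx => ?_, fun x hx => ?_⟩ fun x => ?_
    · simp only [Finset.mem_filter_univ, apply_apply_of_mul_self hs1] at *
      exact hx.not_gt
    · simp only [Finset.mem_filter_univ, apply_apply_of_mul_self hs1]
      exact lt_or_gt_of_ne fun h => hx (hfix x h.symm)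
    · simp only [Finset.mem_filter_univ, perm_commute_apply hs2, cycleRep_apply]
  rw [Finset.sum_congr rfl hsign, Finset.sum_const, nsmul_eq_mul, mul_one, Nat.cast_inj]
  choose f hf hf' using fun s hs => exists_commRoot (k := k) (z := z) hκ hz he (s := s) hs
  choose g hg hg' using fun τ hτ => exists_commInvolution (k := k) (z := z) hκ hz (τ := τ) hτ
  have hκi' : ∀ x, κ⁻¹ (κ x) = x := fun x => κ.symm_apply_apply x
  have hκi : ∀ x, κ (κ⁻¹ x) = x := fun x => κ.apply_symm_apply x
  refine Finset.card_bij' f g hf hg (fun s hs => ?_) (fun τ hτ => ?_)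
  · ext x
    rw [hg', hf']
    obtain ⟨hs, e'⟩ := Finset.mem_filter.1 hs
    split_ifs with h h'
    · exact (apply_eq_self_of_odd hz' hκ hs (by rw [← h, ← e']) (he x h)).symm
    · rfl
    · exact hκi' _
  · ext x
    rw [hf', hg']
    obtain ⟨hτ, e'⟩ := Finset.mem_filter.1 hτ
    split_ifs with h h'
    · exact (apply_eq_pow_of_odd hz' hκ hτ (by rw [← h, ← e']) (he x h)).symm
    · rfl
    · exact hκi _

/-- The signed count of the involutions commuting with `σ` is a count of square roots. -/
theorem sum_pairSign_eq_card_commRoots {j : ℕ} (hκ : κ = σ ^ j) (hz : ∀ x, z (κ x) = z x)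
    (hz' : ∀ x (i : ℕ), z ((σ ^ i) x) = z x → ∃ l : ℕ, (σ ^ i) x = (κ ^ l) x) :
    ∑ s ∈ commInvolutions σ z, pairSign s σ = (commRoots σ κ z).card := by
  -- Both sides are sorted by the map `k` that records which cycle each point is sent to. Fibre by
  -- fibre, either both contributions vanish or the bijection applies.
  rw [← Finset.sum_fiberwise (commInvolutions σ z) (fun s => (fun x => cycleRep σ (s x))),
    Finset.card_eq_sum_card_fiberwise (f := fun τ => (fun x => cycleRep σ (τ x)))
      (t := Finset.univ) (fun _ _ => Finset.mem_coe.2 (Finset.mem_univ _)), Nat.cast_sum]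
  refine Finset.sum_congr rfl fun k _ => ?_
  by_cases h : ∀ x, k x = cycleRep σ x → ∃ N, Odd N ∧ (κ ^ N) x = x
  · exact sum_pairSign_eq_card_of_odd hκ hz hz' h
  · push Not at h
    obtain ⟨x₀, hk, hodd⟩ := h
    rw [sum_pairSign_eq_zero hκ hz hk hodd, commRoots_filter_eq_empty hz' hk hodd]
    rfl

end SquareRootsOdd

/-! ### Twisted Frobenius–Schur indicators and a criterion for models -/

section TwistedFrobeniusSchur

open Representation TensorProduct

theorem trace_map_comp_comm {V : Type*} [AddCommGroup V] [Module ℂ V] [FiniteDimensional ℂ V]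
    (f g : V →ₗ[ℂ] V) :
    LinearMap.trace ℂ (V ⊗[ℂ] V) (TensorProduct.map f g ∘ₗ (TensorProduct.comm ℂ V V).toLinearMap)
      = LinearMap.trace ℂ V (f * g) := by
  have b := Module.finBasis ℂ V
  rw [LinearMap.trace_eq_matrix_trace ℂ (b.tensorProduct b), LinearMap.trace_eq_matrix_trace ℂ b,
    LinearMap.toMatrix_mul, Matrix.trace, Matrix.trace, Fintype.sum_prod_type]
  refine Finset.sum_congr rfl fun i _ => ?_
  rw [Matrix.diag_apply, Matrix.mul_apply]
  refine Finset.sum_congr rfl fun j _ => ?_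
  simp [LinearMap.toMatrix_apply, Module.Basis.tensorProduct_apply, mul_comm]

/-- The span of one orbit of the finite group is invariant and non-zero. This is needed because the
definition of a model tests irreducible representations of unspecified dimension. -/
theorem finiteDimensional_of_isIrreducible {G V : Type*} [Group G] [Finite G] [AddCommGroup V]
    [Module ℂ V] (σ : Representation ℂ G V) [hσ : σ.IsIrreducible] : FiniteDimensional ℂ V := by
  obtain ⟨v, hv⟩ : ∃ v : V, v ≠ 0 := by
    by_contra! h
    refine bot_ne_top (α := Subrepresentation σ) (SetLike.ext fun x => ?_)
    rw [h x]
    exact ⟨fun _ => (⊤ : Subrepresentation σ).toSubmodule.zero_mem,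
      fun _ => (⊥ : Subrepresentation σ).toSubmodule.zero_mem⟩
  let U : Subrepresentation σ :=
    { toSubmodule := Submodule.span ℂ (Set.range fun g => σ g v)
      apply_mem_toSubmodule := fun g w hw => by
        induction hw using Submodule.span_induction with
        | mem x hx =>
          obtain ⟨h, rfl⟩ := hx
          refine Submodule.subset_span ⟨g * h, ?_⟩
          simp
        | zero => rw [map_zero]; exact Submodule.zero_mem _
        | add x y _ _ hx hy => rw [map_add]; exact Submodule.add_mem _ hx hy
        | smul a x _ hx => rw [map_smul]; exact Submodule.smul_mem _ _ hx }
  have hvU : v ∈ U.toSubmodule := Submodule.subset_span ⟨1, by simp⟩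
  have hU : U = ⊤ := (hσ.eq_bot_or_eq_top U).resolve_left fun h => hv (by
    rw [h] at hvU
    exact (Submodule.mem_bot ℂ).1 hvU)
  have e : Submodule.span ℂ (Set.range fun g => σ g v) = ⊤ :=
    congrArg Subrepresentation.toSubmodule hU
  exact ⟨⟨(Set.finite_range fun g => σ g v).toFinset, by rw [Set.Finite.coe_toFinset, e]⟩⟩

variable {G : Type*} [Group G] [Fintype G]

/-- If `θ` is an involution of `G` such that `θ g` is conjugate to `g⁻¹`, the Frobenius–Schur
indicators of the irreducible representations of `G` twisted by `θ` are signs. -/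
theorem twistedIndicator_sq_eq_one (θ : G →* G) (hθ : ∀ g, θ (θ g) = g)
    (hconj : ∀ g, IsConj g⁻¹ (θ g)) {V : Type*} [AddCommGroup V] [Module ℂ V]
    (σ : Representation ℂ G V) [σ.IsIrreducible] :
    ((Nat.card G : ℂ)⁻¹ * ∑ g : G, σ.character (g * θ g)) ^ 2 = 1 := by
  have : FiniteDimensional ℂ V := finiteDimensional_of_isIrreducible σ
  have hG : (Nat.card G : ℂ) ≠ 0 := Nat.cast_ne_zero.2 Nat.card_pos.ne'
  have : Invertible (Nat.card G : ℂ) := invertibleOfNonzero hG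
  have : Invertible (Fintype.card G : ℂ) := by rw [Fintype.card_eq_nat_card]; assumption
  let σ' : Representation ℂ G V := σ.comp θ
  have hσ' : ∀ g, σ'.character g = σ.character g⁻¹ := fun g => by
    obtain ⟨c, hc⟩ := isConj_iff.1 (hconj g)
    change σ.character (θ g) = _
    rw [← hc, char_conj]
  let τ := tprod σ σ'
  -- Twisting by `θ` yields the character `g ↦ χ(g⁻¹)` of the dual, so the invariants of `τ` have
  -- the dimension of the self-intertwiners of `σ`, which is 1 by Schur's lemma.
  have h1 : Module.finrank ℂ (invariants τ) = 1 := by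
    have e := card_inv_mul_sum_char_eq_finrank τ
    have e' := card_inv_mul_sum_char_mul_char_eq_finrank σ σ
    simp only [τ, char_tensor, Pi.mul_apply, hσ'] at e
    rw [e', IsIrreducible.finrank_intertwiningMap_self] at e
    exact_mod_cast e.symm
  obtain ⟨v, hv0, hv⟩ := finrank_eq_one_iff'.1 h1
  let S : V ⊗[ℂ] V →ₗ[ℂ] V ⊗[ℂ] V := (TensorProduct.comm ℂ V V).toLinearMap
  have hS : ∀ g x, S (τ g x) = τ (θ g) (S x) := by
    intro g x
    induction x using TensorProduct.induction_on with
    | zero => simp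
    | tmul x y => simp [S, τ, σ', hθ]
    | add x y hx hy => simp only [map_add, hx, hy]
  have hSS : ∀ x, S (S x) = x := fun x => by
    induction x using TensorProduct.induction_on with
    | zero => simp
    | tmul x y => simp [S]
    | add x y hx hy => simp only [map_add, hx, hy]
  -- The swap exchanges `τ g` and `τ (θ g)`, so it stabilises the invariant line and acts on it by a
  -- scalar `c` with `c ^ 2 = 1`.
  have hSinv : ∀ x ∈ invariants τ, S x ∈ invariants τ := fun x hx g => by
    have := hS (θ g) x
    rw [hθ, hx (θ g)] at this
    exact this.symm
  obtain ⟨c, hc⟩ := hv ⟨S v, hSinv _ v.2⟩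
  have hc' : S v = c • (v : V ⊗[ℂ] V) := (congrArg Subtype.val hc).symm
  have hcc : c ^ 2 = 1 := by
    have e := hSS v
    rw [hc', map_smul, hc', smul_smul, ← sq] at e
    have e2 : (c ^ 2 - 1) • (v : V ⊗[ℂ] V) = 0 := by rw [sub_smul, e, one_smul, sub_self]
    exact sub_eq_zero.1 ((smul_eq_zero.1 e2).resolve_right fun h => hv0 (Subtype.ext h))
  let P : V ⊗[ℂ] V →ₗ[ℂ] V ⊗[ℂ] V := averageMap τ
  -- The trace of averaging after the swap is computed twice: termwise it is the twisted indicator,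
  -- and as an operator of rank at most one with image in the invariant line it is `c`.
  have htr : LinearMap.trace ℂ _ (P ∘ₗ S) =
      (Nat.card G : ℂ)⁻¹ * ∑ g : G, σ.character (g * θ g) := by
    have hP : P = (Nat.card G : ℂ)⁻¹ • ∑ g : G, τ g := by
      simp [P, averageMap, GroupAlgebra.average, _root_.map_sum]
    rw [hP, LinearMap.smul_comp, map_smul, smul_eq_mul,
      show (∑ g : G, τ g) ∘ₗ S = ∑ g : G, τ g * S from Finset.sum_mul _ _ _, _root_.map_sum]
    congr 1
    refine Finset.sum_congr rfl fun g _ => ?_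
    rw [character, σ.map_mul]
    exact trace_map_comp_comm (σ g) (σ' g)
  have hcoef : ∃ φ : V ⊗[ℂ] V →ₗ[ℂ] ℂ, P ∘ₗ S = φ.smulRight (v : V ⊗[ℂ] V) := by
    let e : ℂ ≃ₗ[ℂ] invariants τ := LinearEquiv.ofBijective (LinearMap.toSpanSingleton ℂ _ v)
      ⟨fun a b hab => smul_left_injective ℂ hv0 hab, fun w => hv w⟩
    refine ⟨e.symm.toLinearMap ∘ₗ LinearMap.codRestrict (invariants τ) (P ∘ₗ S)
      (fun x => averageMap_invariant τ (S x)), LinearMap.ext fun x => ?_⟩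
    have := e.apply_symm_apply (LinearMap.codRestrict (invariants τ) (P ∘ₗ S)
      (fun x => averageMap_invariant τ (S x)) x)
    exact (congrArg Subtype.val this).symm
  obtain ⟨φ, hφ⟩ := hcoef
  have hφv : φ v = c := by
    have e1 : (P ∘ₗ S) v = c • (v : V ⊗[ℂ] V) := by
      rw [LinearMap.comp_apply, hc', map_smul]
      congr 1
      exact averageMap_id τ v v.2
    rw [hφ, LinearMap.smulRight_apply] at e1
    exact smul_left_injective ℂ (fun h => hv0 (Subtype.ext h)) e1
  rw [← htr, hφ, LinearMap.trace_smulRight, hφv, hcc]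

theorem isIrreducible_of_isAtom {G M : Type*} [Group G] [AddCommGroup M] [Module ℂ M]
    {ρ : Representation ℂ G M} {W : Subrepresentation ρ} (hW : IsAtom W) :
    W.toRepresentation.IsIrreducible := by
  have hlift : ∀ U : Subrepresentation W.toRepresentation, ∃ U' : Subrepresentation ρ,
      U'.toSubmodule = U.toSubmodule.map W.toSubmodule.subtype := fun U =>
    ⟨{ toSubmodule := U.toSubmodule.map W.toSubmodule.subtype
       apply_mem_toSubmodule := by
        rintro g _ ⟨x, hx, rfl⟩
        exact ⟨W.toRepresentation g x, U.apply_mem_toSubmodule g hx, rfl⟩ }, rfl⟩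
  refine { exists_pair_ne := ⟨⊥, ⊤, fun h => hW.1 ?_⟩, eq_bot_or_eq_top := fun U => ?_ }
  · refine SetLike.ext fun x => ⟨fun hx => ?_, fun hx => ?_⟩
    · have h1 : (⟨x, hx⟩ : W.toSubmodule) ∈ (⊤ : Submodule ℂ W.toSubmodule) := trivial
      have h2 : (⊥ : Submodule ℂ W.toSubmodule) = ⊤ := congrArg Subrepresentation.toSubmodule h
      rw [← h2, Submodule.mem_bot] at h1
      exact (Submodule.mem_bot ℂ).2 (congrArg Subtype.val h1)
    · rw [(Submodule.mem_bot ℂ).1 hx]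
      exact W.toSubmodule.zero_mem
  · obtain ⟨U', hU'⟩ := hlift U
    have hle : U' ≤ W := by
      intro x hx
      have hx' : x ∈ U'.toSubmodule := hx
      rw [hU'] at hx'
      obtain ⟨y, _, rfl⟩ := hx'
      exact y.2
    rcases hW.le_iff.1 hle with h | h
    · left
      apply Subrepresentation.toSubmodule_injective
      rw [h] at hU'
      exact Submodule.map_injective_of_injective W.toSubmodule.injective_subtype
        (hU'.symm.trans (Submodule.map_bot _).symm)
    · right
      apply Subrepresentation.toSubmodule_injective
      rw [h] at hU'
      have h3 : U.toSubmodule.map W.toSubmodule.subtype =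
          (⊤ : Submodule ℂ W.toSubmodule).map W.toSubmodule.subtype := by
        rw [← hU', Submodule.map_top, Submodule.range_subtype]
      exact Submodule.map_injective_of_injective W.toSubmodule.injective_subtype h3

/-- Maschke's theorem over the group algebra, carried back to subrepresentations; finite dimension
bounds the number of independent summands. -/
theorem exists_isInternal_isIrreducible {M : Type*} [AddCommGroup M] [Module ℂ M]
    [FiniteDimensional ℂ M] (ρ : Representation ℂ G M) :
    ∃ (m : ℕ) (W : Fin m → Subrepresentation ρ),
      DirectSum.IsInternal (fun i => (W i).toSubmodule) ∧
      ∀ i, (W i).toRepresentation.IsIrreducible := by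
  have : NeZero (Nat.card G : ℂ) := ⟨Nat.cast_ne_zero.2 Nat.card_pos.ne'⟩
  have hss : IsSemisimpleModule (MonoidAlgebra ℂ G) ρ.asModule := inferInstance
  obtain ⟨s, hind, hsup, hsimple⟩ :=
    IsSemisimpleModule.exists_sSupIndep_sSup_simples_eq_top (MonoidAlgebra ℂ G) ρ.asModule
  have hmono : StrictMono fun N : Submodule (MonoidAlgebra ℂ G) ρ.asModule =>
      (Subrepresentation.ofSubmodule' N).toSubmodule := by
    intro N N' h
    exact h
  have : WellFoundedGT (Submodule (MonoidAlgebra ℂ G) ρ.asModule) := hmono.wellFoundedGT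
  have hfin : s.Finite := WellFoundedGT.finite_of_sSupIndep hind
  have := hfin.fintype
  let e := (Fintype.equivFin s).symm
  refine ⟨Fintype.card s, fun i => Subrepresentation.ofSubmodule' (e i).1, ?_, fun i => ?_⟩
  · have h := DirectSum.isInternal_submodule_of_iSupIndep_of_iSup_eq_top
      (A := fun i => (e i).1) (((sSupIndep_iff s).1 hind).comp e.injective) (by
        rw [e.surjective.iSup_comp (g := fun x : s => x.1), ← sSup_eq_iSup', hsup])
    exact h
  · refine isIrreducible_of_isAtom ?_
    have := isSimpleModule_iff_isAtom.1 (hsimple _ (e i).2)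
    exact (Subrepresentation.subrepresentationSubmoduleOrderIso (ρ := ρ)).symm.isAtom_iff _ |>.2 this

theorem sum_card_mul_eq_sum_comp {ι G : Type*} [Fintype ι] [Fintype G]
    [DecidableEq G] (f : ι → G) (F : G → ℂ) :
    ∑ g, (Finset.card {h | f h = g} : ℂ) * F g = ∑ h, F (f h) := by
  rw [← Finset.sum_fiberwise Finset.univ f]
  refine Finset.sum_congr rfl fun g _ => ?_
  rw [← nsmul_eq_mul, ← Finset.sum_const]
  exact Finset.sum_congr rfl fun h hh => by rw [(Finset.mem_filter.1 hh).2]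

section Multiplicity

variable (θ : G →* G) (hθ : ∀ g, θ (θ g) = g) (hconj : ∀ g, IsConj g⁻¹ (θ g))
  {M : Type*} [AddCommGroup M] [Module ℂ M] [FiniteDimensional ℂ M] (ρ : Representation ℂ G M)
  [DecidableEq G] (hρ : ∀ g, ρ.character g = (Finset.card {h : G | h * θ h = g} : ℂ))

include hθ hconj hρ

/-- Inserting the count for the character of `ρ` and substituting `h ↦ h⁻¹` turns the multiplicity
of `σ` into its twisted indicator. It is a natural number with square 1. -/
theorem average_character_mul_eq_one {V : Type*} [AddCommGroup V] [Module ℂ V]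
    (σ : Representation ℂ G V) [σ.IsIrreducible] :
    (Nat.card G : ℂ)⁻¹ * ∑ g : G, ρ.character g * σ.character g⁻¹ = 1 := by
  have : FiniteDimensional ℂ V := finiteDimensional_of_isIrreducible σ
  have hG : (Nat.card G : ℂ) ≠ 0 := Nat.cast_ne_zero.2 Nat.card_pos.ne'
  have : Invertible (Nat.card G : ℂ) := invertibleOfNonzero hG
  have h1 := twistedIndicator_sq_eq_one θ hθ hconj σ
  have h2 : ∑ g : G, ρ.character g * σ.character g⁻¹ = ∑ g : G, σ.character (g * θ g) := by
    simp_rw [hρ]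
    rw [sum_card_mul_eq_sum_comp (fun h => h * θ h) fun g => σ.character g⁻¹]
    refine Fintype.sum_equiv (Equiv.inv G) _ _ fun h => ?_
    rw [mul_inv_rev, char_mul_comm, Equiv.inv_apply, map_inv]
  rw [← h2, card_inv_mul_sum_char_mul_char_eq_finrank] at h1
  rw [card_inv_mul_sum_char_mul_char_eq_finrank]
  have h3 : Module.finrank ℂ (IntertwiningMap σ ρ) ^ 2 = 1 := by exact_mod_cast h1
  have h4 : Module.finrank ℂ (IntertwiningMap σ ρ) = 1 :=
    (pow_eq_one_iff.1 h3).resolve_right two_ne_zero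
  rw [h4, Nat.cast_one]

-- Orthonormality of irreducible characters converts the multiplicity 1 into exactly one summand
-- isomorphic to `σ`, giving both existence and non-repetition.
open scoped Classical in
theorem card_equiv_summand_eq_one {m : ℕ} {W : Fin m → Subrepresentation ρ}
    (hint : DirectSum.IsInternal (fun i => (W i).toSubmodule))
    (hirr : ∀ i, (W i).toRepresentation.IsIrreducible) {V : Type*} [AddCommGroup V] [Module ℂ V]
    (σ : Representation ℂ G V) [σ.IsIrreducible] :
    Finset.card {i | Nonempty (σ.Equiv (W i).toRepresentation)} = 1 := by
  have : FiniteDimensional ℂ V := finiteDimensional_of_isIrreducible σ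
  have hG : (Nat.card G : ℂ) ≠ 0 := Nat.cast_ne_zero.2 Nat.card_pos.ne'
  have : Invertible (Nat.card G : ℂ) := invertibleOfNonzero hG
  have hsum : ∀ g, ρ.character g = ∑ i, (W i).toRepresentation.character g := fun g =>
    LinearMap.trace_eq_sum_trace_restrict hint fun i => (W i).apply_mem_toSubmodule g
  have h := average_character_mul_eq_one θ hθ hconj ρ hρ σ
  simp_rw [hsum, Finset.sum_mul] at h
  rw [Finset.sum_comm, Finset.mul_sum] at h
  have h' : ∀ i, (Nat.card G : ℂ)⁻¹ *
      ∑ g : G, (W i).toRepresentation.character g * σ.character g⁻¹ =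
      if Nonempty (σ.Equiv (W i).toRepresentation) then 1 else 0 := fun i => by
    have := hirr i
    exact char_orthonormal (W i).toRepresentation σ
  simp_rw [h'] at h
  rw [Finset.sum_boole] at h
  exact_mod_cast h

/-- A representation whose character counts the solutions of `h * θ h = g` is a model. -/
theorem isModel_of_character_eq_card : IsModel.{u} ρ := by
  classical
  obtain ⟨m, W, hint, hirr⟩ := exists_isInternal_isIrreducible ρ
  refine ⟨m, W, hint, hirr, fun i j hij => ?_, fun V _ _ σ hσ => ?_⟩
  · have := hirr i
    have h := card_equiv_summand_eq_one θ hθ hconj ρ hρ hint hirr (W i).toRepresentation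
    exact Finset.card_le_one.1 h.le i (by simpa using ⟨Representation.Equiv.refl _⟩) j (by simpa using hij)
  · have h := card_equiv_summand_eq_one θ hθ hconj ρ hρ hint hirr σ
    obtain ⟨i, hi⟩ := Finset.card_pos.1 (h ▸ one_pos)
    exact ⟨i, by simpa using hi⟩

end Multiplicity

end TwistedFrobeniusSchur

/-! ### Character sums over `ℤ/r`, and reversal of a permutation -/

section Fourier

variable {r p n : ℕ}

/-- Summing over all indices shows that `n` kills `c`, as `p` does; by Bézout so does `GCD(p,n)`.
This is where the hypothesis on `p` and `n` enters. -/
theorem two_mul_eq_zero_of_translate (hgcd : Nat.gcd p n = 1 ∨ Nat.gcd p n = 2)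
    {y : Fin n → ZMod r} {τ : Equiv.Perm (Fin n)} {c : ZMod r} (hc : (p : ZMod r) * c = 0)
    (hy : ∀ i, y (τ i) = y i + c) : 2 * c = 0 := by
  have hn : (n : ZMod r) * c = 0 := by
    have h := Equiv.sum_comp τ y
    simp only [hy, Finset.sum_add_distrib, Finset.sum_const, Finset.card_univ, Fintype.card_fin,
      nsmul_eq_mul] at h
    exact left_eq_add.1 h.symm
  have hg : ((Nat.gcd p n : ℕ) : ZMod r) * c = 0 := by
    have h : ((Nat.gcd p n : ℤ) : ZMod r) = ((p * Nat.gcdA p n + n * Nat.gcdB p n : ℤ) : ZMod r) :=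
      congrArg _ (Nat.gcd_eq_gcd_ab p n)
    push_cast at h
    rw [h]
    linear_combination (Nat.gcdA p n : ZMod r) * hc + (Nat.gcdB p n : ZMod r) * hn
  rcases hgcd with h | h
  · rw [h, Nat.cast_one, one_mul] at hg
    rw [hg, mul_zero]
  · rw [h] at hg
    exact_mod_cast hg

variable [NeZero r]

theorem mul_eq_zero_iff_exists_lt (hpr : p ∣ r) (c : ZMod r) :
    (p : ZMod r) * c = 0 ↔ ∃ k < p, c = ((r / p : ℕ) : ZMod r) * (k : ZMod r) := by
  obtain ⟨q, rfl⟩ := hpr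
  have hp : 0 < p := Nat.pos_of_ne_zero fun h => NeZero.ne (p * q) (by simp [h])
  rw [Nat.mul_div_cancel_left _ hp]
  constructor
  · intro h
    rw [← ZMod.natCast_zmod_val c, ← Nat.cast_mul, ZMod.natCast_eq_zero_iff] at h
    obtain ⟨k, hk⟩ := Nat.dvd_of_mul_dvd_mul_left hp h
    refine ⟨k, ?_, by rw [← Nat.cast_mul, ← hk, ZMod.natCast_zmod_val]⟩
    have := ZMod.val_lt c
    rw [hk, mul_comm p] at this
    exact Nat.lt_of_mul_lt_mul_left this
  · rintro ⟨k, -, rfl⟩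
    rw [← mul_assoc, ← Nat.cast_mul, ZMod.natCast_self, zero_mul]

theorem div_mul_eq_zero_iff (hpr : p ∣ r) (a : ZMod r) :
    ((r / p : ℕ) : ZMod r) * a = 0 ↔ (p : ZMod r) ∣ a := by
  obtain ⟨q, rfl⟩ := hpr
  have hp : 0 < p := Nat.pos_of_ne_zero fun h => NeZero.ne (p * q) (by simp [h])
  have hq : 0 < q := Nat.pos_of_ne_zero fun h => NeZero.ne (p * q) (by simp [h])
  rw [Nat.mul_div_cancel_left _ hp]
  constructor
  · intro h
    rw [← ZMod.natCast_zmod_val a, ← Nat.cast_mul, ZMod.natCast_eq_zero_iff] at h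
    obtain ⟨k, hk⟩ := Nat.dvd_of_mul_dvd_mul_right hq (h.trans (mul_comm q _).dvd)
    exact ⟨k, by rw [← Nat.cast_mul, ← hk, ZMod.natCast_zmod_val]⟩
  · rintro ⟨k, rfl⟩
    rw [← mul_assoc, ← Nat.cast_mul, mul_comm q, ZMod.natCast_self, zero_mul]

theorem injOn_div_mul (hpr : p ∣ r) :
    Set.InjOn (fun k : ℕ => ((r / p : ℕ) : ZMod r) * (k : ZMod r)) (Finset.range p) := by
  obtain ⟨q, rfl⟩ := hpr
  have hp : 0 < p := Nat.pos_of_ne_zero fun h => NeZero.ne (p * q) (by simp [h])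
  have hq : 0 < q := Nat.pos_of_ne_zero fun h => NeZero.ne (p * q) (by simp [h])
  intro k hk l hl h
  simp only [Finset.coe_range, Set.mem_Iio] at hk hl
  simp only [Nat.mul_div_cancel_left _ hp, ← Nat.cast_mul] at h
  rw [ZMod.natCast_eq_natCast_iff', Nat.mod_eq_of_lt, Nat.mod_eq_of_lt] at h
  · exact Nat.eq_of_mul_eq_mul_left hq h
  · rw [mul_comm p]
    exact Nat.mul_lt_mul_of_pos_left hl hq
  · rw [mul_comm p]
    exact Nat.mul_lt_mul_of_pos_left hk hq

theorem filter_mul_eq_zero (hpr : p ∣ r) :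
    ({c : ZMod r | (p : ZMod r) * c = 0} : Finset (ZMod r)) =
      (Finset.range p).image fun k : ℕ => ((r / p : ℕ) : ZMod r) * (k : ZMod r) := by
  ext c
  simp only [Finset.mem_filter_univ, mul_eq_zero_iff_exists_lt hpr, Finset.mem_image,
    Finset.mem_range, eq_comm]

theorem card_filter_mul_eq_zero (hpr : p ∣ r) :
    Finset.card {c : ZMod r | (p : ZMod r) * c = 0} = p := by
  rw [filter_mul_eq_zero hpr, Finset.card_image_of_injOn (injOn_div_mul hpr), Finset.card_range]

theorem sum_stdAddChar_mul_of_mul_eq_zero (hpr : p ∣ r) (a : ZMod r)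
    [Decidable ((p : ZMod r) ∣ a)] :
    ∑ c : ZMod r with (p : ZMod r) * c = 0, ZMod.stdAddChar (c * a) =
      if (p : ZMod r) ∣ a then (p : ℂ) else 0 := by
  rw [filter_mul_eq_zero hpr, Finset.sum_image (injOn_div_mul hpr)]
  have e : ∀ k : ℕ, ZMod.stdAddChar (((r / p : ℕ) : ZMod r) * (k : ZMod r) * a) =
      ZMod.stdAddChar (((r / p : ℕ) : ZMod r) * a) ^ k := fun k => by
    rw [← AddChar.map_nsmul_eq_pow, nsmul_eq_mul]
    congr 1
    ring
  simp_rw [e]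
  split_ifs with h
  · rw [(div_mul_eq_zero_iff hpr a).2 h]
    simp
  · have hne : ZMod.stdAddChar (((r / p : ℕ) : ZMod r) * a) ≠ 1 := fun h1 =>
      h ((div_mul_eq_zero_iff hpr a).1 (ZMod.injective_stdAddChar (h1.trans
        (AddChar.map_zero_eq_one _).symm)))
    rw [geom_sum_eq hne, ← AddChar.map_nsmul_eq_pow, nsmul_eq_mul, ← mul_assoc, ← Nat.cast_mul,
      Nat.mul_div_cancel' hpr, ZMod.natCast_self, zero_mul, AddChar.map_zero_eq_one, sub_self,
      zero_div]

theorem sum_stdAddChar_pairing (u : Fin n → ZMod r) :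
    ∑ w : Fin n → ZMod r, ZMod.stdAddChar (∑ i, w i * u i) =
      if ∀ i, u i = 0 then (r : ℂ) ^ n else 0 := by
  classical
  let f : (Fin n → ZMod r) →+ ZMod r :=
    { toFun := fun w => ∑ i, w i * u i
      map_zero' := by simp
      map_add' := fun w w' => by simp [add_mul, Finset.sum_add_distrib] }
  have h := AddChar.sum_eq_ite ((ZMod.stdAddChar (N := r)).compAddMonoidHom f)
  have hiff : (ZMod.stdAddChar (N := r)).compAddMonoidHom f = 0 ↔ ∀ i, u i = 0 := by
    constructor
    · intro h0 i
      have h1 := DFunLike.congr_fun h0 (Pi.single i 1)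
      have h2 : f (Pi.single i 1) = u i := by simp [f, Pi.single_apply]
      rw [AddChar.compAddMonoidHom_apply, h2] at h1
      exact ZMod.injective_stdAddChar (h1.trans (AddChar.map_zero_eq_one _).symm)
    · intro h0
      ext w
      simp [AddChar.compAddMonoidHom_apply, f, h0]
  simp only [hiff] at h
  simpa [AddChar.compAddMonoidHom_apply, f] using h

theorem stdAddChar_sum_add (a b : ZMod r) :
    ZMod.stdAddChar (a + b) = ZMod.stdAddChar a * ZMod.stdAddChar b :=
  AddChar.map_add_eq_mul _ a b

/-- The number of `w` of total colour divisible by `p` with `w ∘ τ - w = b`, as a character sum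
over the `y` that `τ` translates by a constant killed by `p`. -/
theorem mul_card_coboundary_eq [NeZero n] (hpr : p ∣ r) (τ : Equiv.Perm (Fin n))
    (b : Fin n → ZMod r) [DecidablePred fun w : Fin n → ZMod r => (p : ZMod r) ∣ ∑ i, w i] :
    (p : ℂ) * Finset.card {w : Fin n → ZMod r |
        (∀ i, w (τ i) - w i = b i) ∧ (p : ZMod r) ∣ ∑ i, w i} =
      ∑ y : Fin n → ZMod r with ∃ c : ZMod r, (p : ZMod r) * c = 0 ∧ ∀ i, y (τ i) = y i + c,
        ZMod.stdAddChar (-∑ i, y i * b i) := by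
  have hr : (r : ℂ) ^ n ≠ 0 := pow_ne_zero _ (Nat.cast_ne_zero.2 (NeZero.ne r))
  apply mul_left_cancel₀ hr
  -- Both conditions on `w` are detected by orthogonality: `y` tests the coboundary equation and `c`
  -- tests divisibility of the total colour.
  have e1 : (r : ℂ) ^ n * ((p : ℂ) * Finset.card {w : Fin n → ZMod r |
        (∀ i, w (τ i) - w i = b i) ∧ (p : ZMod r) ∣ ∑ i, w i}) =
      ∑ w : Fin n → ZMod r, (∑ y : Fin n → ZMod r,
        ZMod.stdAddChar (∑ i, y i * (w (τ i) - w i - b i))) *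
        ∑ c : ZMod r with (p : ZMod r) * c = 0, ZMod.stdAddChar (c * ∑ i, w i) := by
    rw [Finset.card_filter, Nat.cast_sum, Finset.mul_sum, Finset.mul_sum]
    refine Finset.sum_congr rfl fun w _ => ?_
    rw [sum_stdAddChar_pairing, sum_stdAddChar_mul_of_mul_eq_zero hpr]
    simp only [sub_eq_zero]
    split_ifs <;> simp_all
  -- Moving `τ` from `w` to `y` makes the exponent linear in `w`, so the sum over `w` forces `y` to
  -- be translated by `c`.
  have e2 : ∀ (w y : Fin n → ZMod r) (c : ZMod r),
      (ZMod.stdAddChar (∑ i, y i * (w (τ i) - w i - b i)) : ℂ) * ZMod.stdAddChar (c * ∑ i, w i) =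
      ZMod.stdAddChar (-∑ i, y i * b i) *
        ZMod.stdAddChar (∑ i, w i * (y (τ⁻¹ i) - y i + c)) := by
    intro w y c
    rw [← stdAddChar_sum_add, ← stdAddChar_sum_add]
    congr 1
    have e3 : ∑ i, y i * w (τ i) = ∑ i, y (τ⁻¹ i) * w i := by
      rw [← Equiv.sum_comp τ fun i => y (τ⁻¹ i) * w i]
      simp
    simp only [mul_sub, mul_add, Finset.sum_add_distrib, Finset.sum_sub_distrib, e3,
      Finset.mul_sum]
    simp only [mul_comm (w _)]
    ring
  rw [e1]
  simp_rw [Finset.sum_mul_sum, e2]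
  rw [Finset.sum_comm]
  have e4 : ∀ y : Fin n → ZMod r, (∑ w : Fin n → ZMod r, ∑ c : ZMod r with (p : ZMod r) * c = 0,
      (ZMod.stdAddChar (-∑ i, y i * b i) : ℂ) *
        ZMod.stdAddChar (∑ i, w i * (y (τ⁻¹ i) - y i + c))) =
      if ∃ c : ZMod r, (p : ZMod r) * c = 0 ∧ ∀ i, y (τ i) = y i + c then
        (r : ℂ) ^ n * ZMod.stdAddChar (-∑ i, y i * b i) else 0 := by
    intro y
    rw [Finset.sum_comm]
    simp_rw [← Finset.mul_sum, sum_stdAddChar_pairing]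
    have e5 : ∀ c, (∀ i, y (τ⁻¹ i) - y i + c = 0) ↔ ∀ i, y (τ i) = y i + c := by
      intro c
      constructor
      · intro h i
        have := h (τ i)
        rw [show τ⁻¹ (τ i) = i from τ.symm_apply_apply i] at this
        linear_combination -this
      · intro h i
        have := h (τ⁻¹ i)
        rw [show τ (τ⁻¹ i) = i from τ.apply_symm_apply i] at this
        linear_combination -this
    simp_rw [e5]
    split_ifs with h
    · obtain ⟨c, hc, hy⟩ := h
      -- The value at the index `0` determines `c` from `y`, so each `y` is counted once.
      rw [Finset.sum_eq_single_of_mem c (by simpa using hc), if_pos hy, mul_comm]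
      intro c' _ hne
      rw [if_neg]
      intro hy'
      exact hne (add_left_cancel ((hy' 0).symm.trans (hy 0)))
    · refine mul_eq_zero_of_right _ (Finset.sum_eq_zero fun c hc => ?_)
      rw [if_neg fun hy => h ⟨c, by simpa using hc, hy⟩]
  simp_rw [e4]
  rw [← Finset.sum_filter, Finset.mul_sum]

/-- A permutation is conjugate to its inverse by an involution that moves every point by an even
power of it. -/
theorem exists_reversing_perm {α : Type*} [Finite α] (σ : Equiv.Perm α) :
    ∃ φ : Equiv.Perm α, (∀ x, φ (φ x) = x) ∧ (∀ x, φ (σ⁻¹ x) = σ (φ x)) ∧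
      ∀ x, ∃ j : ℕ, φ x = ((σ ^ 2) ^ j) x := by
  choose j hj using sameCycle_cycleRep σ
  have key : ∀ (i : ℤ) x, (σ ^ i) (cycleRep σ x) = x →
      (σ ^ (-j x)) (cycleRep σ x) = (σ ^ (-i)) (cycleRep σ x) := by
    intro i x hi
    apply (σ ^ (i + j x)).injective
    rw [← Equiv.Perm.mul_apply, ← Equiv.Perm.mul_apply, ← zpow_add, ← zpow_add,
      add_neg_cancel_right, add_neg_cancel_comm, hi, hj]
  have hrep : ∀ (i : ℤ) x, cycleRep σ ((σ ^ i) x) = cycleRep σ x := fun i x =>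
    cycleRep_eq_iff.2 (Equiv.Perm.SameCycle.symm ⟨i, rfl⟩)
  have hrr : ∀ x, cycleRep σ (cycleRep σ x) = cycleRep σ x := fun x =>
    cycleRep_eq_iff.2 (sameCycle_cycleRep σ x)
  set f : α → α := fun x => (σ ^ (-j x)) (cycleRep σ x) with hf
  have hff : ∀ x, f (f x) = x := by
    intro x
    have e : cycleRep σ (f x) = cycleRep σ x := by rw [hf]; simp only [hrep, hrr]
    have := key (-j x) (f x) (by rw [e])
    rw [e, neg_neg, hj] at this
    change (σ ^ (-j (f x))) (cycleRep σ (f x)) = x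
    rw [e]
    exact this
  refine ⟨Function.Involutive.toPerm f hff, hff, fun x => ?_, fun x => ?_⟩
  · change f (σ⁻¹ x) = σ (f x)
    have e : cycleRep σ (σ⁻¹ x) = cycleRep σ x := by
      simpa using hrep (-1) x
    have := key (-1 + j x) (σ⁻¹ x) (by
      rw [e, zpow_add, Equiv.Perm.mul_apply, hj, zpow_neg_one])
    change (σ ^ (-j (σ⁻¹ x))) (cycleRep σ (σ⁻¹ x)) = _
    rw [this, e, neg_add, neg_neg, zpow_add, zpow_one, Equiv.Perm.mul_apply]
  · have h : (σ ^ 2).SameCycle x (f x) := by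
      refine ⟨-j x, ?_⟩
      conv_lhs => rw [← hj x]
      rw [hj x, ← zpow_natCast, ← zpow_mul]
      change _ = (σ ^ (-j x)) (cycleRep σ x)
      conv_lhs => rw [← hj x]
      rw [← Equiv.Perm.mul_apply, hj x, ← zpow_add]
      congr 2
      push_cast
      ring
    obtain ⟨i, hi⟩ := sameCycle_iff_exists_nat_pow.1 h
    exact ⟨i, hi.symm⟩

end Fourier

/-! ### Complex conjugation on `G(r,p,n)` and the equation `h h̄ = g` -/

section BarRoots

variable {r p n : ℕ}

/-- A coloured permutation is a permutation together with a colouring. -/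
def ColoredPerm.equivProd : ColoredPerm r n ≃ Equiv.Perm (Fin n) × (Fin n → ZMod r) where
  toFun g := (g.perm, g.color)
  invFun x := ⟨x.1, x.2⟩

noncomputable instance [NeZero r] : Fintype (ColoredPerm r n) :=
  Fintype.ofEquiv _ ColoredPerm.equivProd.symm

/-- Complex conjugation on `G(r,p,n)`. -/
def reflGroup.bar : reflGroup r p n →* reflGroup r p n :=
  (ColoredPerm.bar.comp (reflGroup r p n).subtype).codRestrict _ fun g => by
    have h : (p : ZMod r) ∣ ∑ i, g.1.color i := g.2
    change (p : ZMod r) ∣ ∑ i, -g.1.color i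
    rwa [Finset.sum_neg_distrib, dvd_neg]

theorem reflGroup.bar_bar (g : reflGroup r p n) : bar (bar g) = g := by
  apply Subtype.ext
  ext i
  · rfl
  · exact neg_neg _

variable [NeZero r]

/-- In `G(r,p,n)` with `GCD(p,n) ≤ 2`, the inverse of an element is conjugate to its complex
conjugate. -/
theorem reflGroup.isConj_inv_bar [NeZero n] (hpr : p ∣ r)
    (hgcd : Nat.gcd p n = 1 ∨ Nat.gcd p n = 2) (g : reflGroup r p n) : IsConj g⁻¹ (bar g) := by
  classical
  obtain ⟨φ, hφφ, hφσ, hφ⟩ := exists_reversing_perm g.1.perm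
  set σ := g.1.perm with hσ
  set z := g.1.color with hz
  have hσi : ∀ i, σ (σ⁻¹ i) = i := σ.apply_symm_apply
  have hσi' : ∀ i, σ⁻¹ (σ i) = i := σ.symm_apply_apply
  -- A conjugator is sought as `(φ, w)`; its colours `w` must solve a coboundary equation with
  -- right-hand side `z (σ⁻¹ i) - z (φ i)`. Here `φ` moves points by even powers of `σ`, so it
  -- preserves any `y` translated by a constant `c` with `2 * c = 0`. Thus every character in the
  -- counting formula takes the value 1.
  have hterm : ∀ y : Fin n → ZMod r,
      (∃ c : ZMod r, (p : ZMod r) * c = 0 ∧ ∀ i, y (σ⁻¹ i) = y i + c) →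
      ∑ i, y i * (z (σ⁻¹ i) - z (φ i)) = 0 := by
    rintro y ⟨c, hc, hy⟩
    have h2 := two_mul_eq_zero_of_translate hgcd hc hy
    have hy' : ∀ i, y (σ i) = y i - c := fun i => by
      have := hy (σ i)
      rw [hσi'] at this
      rw [this, add_sub_cancel_right]
    have hyφ : ∀ i, y (φ i) = y i := by
      intro i
      obtain ⟨j, hj⟩ := hφ i
      rw [hj]
      clear hj
      induction j with
      | zero => rfl
      | succ j ih =>
        rw [pow_succ', Equiv.Perm.mul_apply, show ∀ x, (σ ^ 2) x = σ (σ x) from fun _ => rfl, hy', hy', ih]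
        linear_combination -h2
    have e1 : ∑ i, y i * z (σ⁻¹ i) = ∑ i, y (σ i) * z i := by
      rw [← Equiv.sum_comp σ]
      simp only [hσi']
    have e2 : ∑ i, y i * z (φ i) = ∑ i, y i * z i := by
      rw [← Equiv.sum_comp φ]
      simp only [hφφ, hyφ]
    obtain ⟨d, hd⟩ : (p : ZMod r) ∣ ∑ i, z i := g.2
    simp only [mul_sub, Finset.sum_sub_distrib, e1, e2]
    rw [← Finset.sum_sub_distrib]
    have e3 : ∀ i, y (σ i) * z i - y i * z i = -c * z i := fun i => by rw [hy']; ring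
    simp only [e3, ← Finset.mul_sum, hd]
    linear_combination (-d) * hc
  have hcount := mul_card_coboundary_eq hpr σ⁻¹ (fun i => z (σ⁻¹ i) - z (φ i))
  rw [Finset.sum_congr rfl fun y hy => by
    rw [hterm y ((Finset.mem_filter_univ y).1 hy), neg_zero, AddChar.map_zero_eq_one]] at hcount
  rw [Finset.sum_const, nsmul_eq_mul, mul_one] at hcount
  -- The number of solutions times `p` equals the number of admissible `y`, which include `0`; so a
  -- solution exists.
  have hpos : 0 < Finset.card {y : Fin n → ZMod r |
      ∃ c : ZMod r, (p : ZMod r) * c = 0 ∧ ∀ i, y (σ⁻¹ i) = y i + c} :=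
    Finset.card_pos.2 ⟨0, (Finset.mem_filter_univ _).2 ⟨0, by simp⟩⟩
  have hne : Finset.card {w : Fin n → ZMod r |
      (∀ i, w (σ⁻¹ i) - w i = z (σ⁻¹ i) - z (φ i)) ∧ (p : ZMod r) ∣ ∑ i, w i} ≠ 0 := by
    intro h0
    rw [h0, Nat.cast_zero, mul_zero, eq_comm, Nat.cast_eq_zero] at hcount
    exact hpos.ne' hcount
  obtain ⟨w, hw⟩ := Finset.card_pos.1 (Nat.pos_of_ne_zero hne)
  obtain ⟨hw1, hw2⟩ := (Finset.mem_filter_univ w).1 hw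
  refine isConj_iff.2 ⟨⟨⟨φ, w⟩, hw2⟩, ?_⟩
  rw [mul_inv_eq_iff_eq_mul]
  apply Subtype.ext
  ext i
  · exact congrArg Fin.val (hφσ i)
  · change -z (σ⁻¹ i) + w (σ⁻¹ i) = w i + -z (φ i)
    linear_combination hw1 i

/-- The square roots of `σ` that translate `z` by a constant killed by `p`. -/
def translateRoots (p : ℕ) (σ : Equiv.Perm (Fin n)) (z : Fin n → ZMod r) :
    Finset (Equiv.Perm (Fin n)) :=
  {τ | τ * τ = σ ∧ ∃ c : ZMod r, (p : ZMod r) * c = 0 ∧ ∀ i, z (τ i) = z i + c}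

theorem translateRoots_neg (σ : Equiv.Perm (Fin n)) (z : Fin n → ZMod r) :
    translateRoots p σ (-z) = translateRoots p σ z := by
  ext τ
  simp only [translateRoots, Finset.mem_filter_univ, Pi.neg_apply]
  refine and_congr_right fun _ => ⟨?_, ?_⟩ <;>
  · rintro ⟨c, hc, h⟩
    exact ⟨-c, by rw [mul_neg, hc, neg_zero], fun i => by linear_combination -h i⟩

theorem card_barRoots [DecidableEq (reflGroup r p n)] [Fintype (reflGroup r p n)]
    (g : reflGroup r p n) [DecidablePred fun w : Fin n → ZMod r => (p : ZMod r) ∣ ∑ i, w i] :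
    Finset.card {h : reflGroup r p n | h * reflGroup.bar h = g} =
      ∑ τ : Equiv.Perm (Fin n) with τ * τ = g.1.perm, Finset.card {w : Fin n → ZMod r |
        (∀ i, w (τ i) - w i = g.1.color i) ∧ (p : ZMod r) ∣ ∑ i, w i} := by
  rw [← Finset.card_sigma]
  have hiff : ∀ h : reflGroup r p n, h * reflGroup.bar h = g ↔ h.1.perm * h.1.perm = g.1.perm ∧
      ∀ i, h.1.color (h.1.perm i) - h.1.color i = g.1.color i := by
    intro h
    rw [← Subtype.coe_inj, ColoredPerm.ext_iff]
    refine and_congr Iff.rfl (funext_iff.trans (forall_congr' fun i => ?_))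
    rw [sub_eq_neg_add]
    rfl
  refine Finset.card_bij' (fun h _ => ⟨h.1.perm, h.1.color⟩)
    (fun x hx => ⟨⟨x.1, x.2⟩, ((Finset.mem_filter_univ _).1 (Finset.mem_sigma.1 hx).2).2⟩)
    (fun h hh => ?_) (fun x hx => ?_) (fun _ _ => rfl) (fun _ _ => rfl)
  · have := (hiff h).1 ((Finset.mem_filter_univ h).1 hh)
    exact Finset.mem_sigma.2 ⟨(Finset.mem_filter_univ _).2 this.1,
      (Finset.mem_filter_univ _).2 ⟨this.2, h.2⟩⟩
  · have h1 := (Finset.mem_filter_univ _).1 (Finset.mem_sigma.1 hx).1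
    have h2 := (Finset.mem_filter_univ _).1 (Finset.mem_sigma.1 hx).2
    exact (Finset.mem_filter_univ (⟨⟨x.1, x.2⟩, h2.2⟩ : reflGroup r p n)).2 ((hiff _).2 ⟨h1, h2.1⟩)

/-- For `h = (τ, w)`, the product `h h̄` has permutation `τ * τ` and colours `w ∘ τ - w`. For each
`τ` the Fourier formula counts the `w`; exchanging the sums and putting `z = -y` collects the `τ`
that translate `z`. -/
theorem mul_card_barRoots [NeZero n] (hpr : p ∣ r) [DecidableEq (reflGroup r p n)]
    [Fintype (reflGroup r p n)] (g : reflGroup r p n) :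
    (p : ℂ) * Finset.card {h : reflGroup r p n | h * reflGroup.bar h = g} =
      ∑ z : Fin n → ZMod r, ZMod.stdAddChar (∑ i, g.1.color i * z i) *
        (translateRoots p g.1.perm z).card := by
  classical
  rw [card_barRoots, Nat.cast_sum, Finset.mul_sum]
  simp_rw [mul_card_coboundary_eq hpr, Finset.sum_filter]
  have e : ∀ τ : Equiv.Perm (Fin n), (if τ * τ = g.1.perm then ∑ y : Fin n → ZMod r,
      (if ∃ c : ZMod r, (p : ZMod r) * c = 0 ∧ ∀ i, y (τ i) = y i + c then
        (ZMod.stdAddChar (-∑ i, y i * g.1.color i) : ℂ) else 0) else 0) =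
      ∑ y : Fin n → ZMod r, if τ ∈ translateRoots p g.1.perm y then
        (ZMod.stdAddChar (-∑ i, y i * g.1.color i) : ℂ) else 0 := by
    intro τ
    by_cases h : τ * τ = g.1.perm <;> simp [translateRoots, h]
  simp_rw [e]
  rw [Finset.sum_comm]
  refine Fintype.sum_equiv (Equiv.neg _) _ _ fun y => ?_
  rw [Equiv.neg_apply, translateRoots_neg, ← Finset.sum_filter, Finset.sum_const, nsmul_eq_mul,
    mul_comm, Finset.filter_mem_eq_inter, Finset.univ_inter]
  congr 2
  simp [mul_comm]

end BarRoots

/-! ### Signed involutions and square roots that translate a colouring -/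

section ColouredInvolutions

variable {r p n : ℕ} [NeZero r]

/-- The only possible element of order two in `ℤ/r` is `r/2`, so all non-zero translation constants
coincide. -/
theorem eq_of_two_mul_eq_zero {a b : ZMod r} (ha : 2 * a = 0) (ha0 : a ≠ 0) (hb : 2 * b = 0)
    (hb0 : b ≠ 0) : a = b := by
  have key : ∀ {a : ZMod r}, 2 * a = 0 → a ≠ 0 → 2 * a.val = r := by
    intro a ha ha0
    rw [← ZMod.natCast_zmod_val a, ← Nat.cast_two, ← Nat.cast_mul, ZMod.natCast_eq_zero_iff] at ha
    obtain ⟨k, hk⟩ := ha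
    have h1 := ZMod.val_lt a
    have h2 : 0 < a.val := Nat.pos_of_ne_zero fun h => ha0 ((ZMod.val_eq_zero a).1 h)
    have h3 : k < 2 := Nat.lt_of_mul_lt_mul_left (a := r) (by omega)
    have h4 : k ≠ 0 := by rintro rfl; omega
    have h5 : k = 1 := by omega
    rw [hk, h5, mul_one]
  apply ZMod.val_injective r
  have := key ha ha0
  have := key hb hb0
  omega

theorem stdAddChar_eq_neg_one {a : ZMod r} (ha : 2 * a = 0) (ha0 : a ≠ 0) :
    (ZMod.stdAddChar a : ℂ) = -1 := by
  have h : (ZMod.stdAddChar a : ℂ) * ZMod.stdAddChar a = 1 := by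
    rw [← stdAddChar_sum_add, ← two_mul, ha, AddChar.map_zero_eq_one]
  refine (mul_self_eq_one_iff.1 h).resolve_left fun h1 => ha0 ?_
  exact ZMod.injective_stdAddChar (h1.trans (AddChar.map_zero_eq_one _).symm)

/-- The involutions commuting with `σ` that translate `z` by a non-zero constant killed by `p`. -/
def translateInvolutions (p : ℕ) (σ : Equiv.Perm (Fin n)) (z : Fin n → ZMod r) :
    Finset (Equiv.Perm (Fin n)) :=
  {s | s * s = 1 ∧ s * σ = σ * s ∧ ∃ c : ZMod r, (p : ZMod r) * c = 0 ∧ c ≠ 0 ∧ ∀ i, z (s i) = z i + c}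

/-- The square roots of `σ` that translate `z` by a non-zero constant killed by `p`. -/
def translateRootsNe (p : ℕ) (σ : Equiv.Perm (Fin n)) (z : Fin n → ZMod r) :
    Finset (Equiv.Perm (Fin n)) :=
  {τ | τ * τ = σ ∧ ∃ c : ZMod r, (p : ZMod r) * c = 0 ∧ c ≠ 0 ∧ ∀ i, z (τ i) = z i + c}

variable {σ : Equiv.Perm (Fin n)} {z : Fin n → ZMod r}

/-- Translation by the element of order two has no fixed colour, so the representatives `val` of the
colours tell up from down. Using `τ` upwards and `τ⁻¹` downwards makes it an involution. -/
theorem exists_translateInvolution (hgcd : Nat.gcd p n = 1 ∨ Nat.gcd p n = 2)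
    {τ : Equiv.Perm (Fin n)} (hτ : τ ∈ translateRootsNe p σ z) :
    ∃ s ∈ translateInvolutions p σ z,
      ∀ x, s x = if (z x).val < (z (τ x)).val then τ x else τ⁻¹ x := by
  simp only [translateRootsNe, Finset.mem_filter_univ] at hτ
  obtain ⟨rfl, c, hc, hc0, hz⟩ := hτ
  have h2 := two_mul_eq_zero_of_translate hgcd hc hz
  have hτi : ∀ x, τ (τ⁻¹ x) = x := τ.apply_symm_apply
  have hτi' : ∀ x, τ⁻¹ (τ x) = x := τ.symm_apply_apply
  have hzi : ∀ x, z (τ⁻¹ x) = z x + c := fun x => by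
    have := hz (τ⁻¹ x)
    rw [hτi] at this
    linear_combination -this - h2
  have hzz : ∀ x, z (τ (τ x)) = z x := fun x => by
    rw [hz, hz]
    linear_combination h2
  have hne : ∀ x, (z x).val ≠ (z (τ x)).val := fun x h => by
    have h1 := ZMod.val_injective r h
    rw [hz] at h1
    exact hc0 (left_eq_add.1 h1)
  set f : Fin n → Fin n := fun x => if (z x).val < (z (τ x)).val then τ x else τ⁻¹ x with hf
  have hff : ∀ x, f (f x) = x := by
    intro x
    by_cases h : (z x).val < (z (τ x)).val
    · have e : f x = τ x := if_pos h
      rw [e]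
      simp only [hf, hzz, h.not_gt, if_false, hτi']
    · have e : f x = τ⁻¹ x := if_neg h
      have h' : (z (τ x)).val < (z x).val := lt_of_le_of_ne (not_lt.1 h) (hne x).symm
      rw [e]
      simp only [hf, hτi, hzi, ← hz]
      rw [if_pos h']
  refine ⟨Function.Involutive.toPerm f hff, ?_, fun x => rfl⟩
  refine (Finset.mem_filter_univ _).2 ⟨?_, ?_, c, hc, hc0, fun x => ?_⟩
  · ext x
    exact congrArg Fin.val (hff x)
  · ext x
    change (f (τ (τ x))).val = (τ (τ (f x))).val
    simp only [hf, hzz]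
    split_ifs
    · rfl
    · rw [hτi, hτi']
  · change z (f x) = z x + c
    simp only [hf]
    split_ifs
    · exact hz x
    · exact hzi x

/-- The converse construction: `s` upwards and `σ ∘ s` downwards squares to `σ`, as `s` commutes
with `σ` and `σ` preserves the colours. -/
theorem exists_translateRoot (hgcd : Nat.gcd p n = 1 ∨ Nat.gcd p n = 2)
    (hσ : ∀ x, z (σ x) = z x) {s : Equiv.Perm (Fin n)} (hs : s ∈ translateInvolutions p σ z) :
    ∃ τ ∈ translateRootsNe p σ z,
      ∀ x, τ x = if (z x).val < (z (s x)).val then s x else σ (s x) := by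
  simp only [translateInvolutions, Finset.mem_filter_univ] at hs
  obtain ⟨hs1, hs2, c, hc, hc0, hz⟩ := hs
  have h2 := two_mul_eq_zero_of_translate hgcd hc hz
  have hss := apply_apply_of_mul_self hs1
  have hne : ∀ x, (z x).val ≠ (z (s x)).val := fun x h => by
    have h1 := ZMod.val_injective r h
    rw [hz] at h1
    exact hc0 (left_eq_add.1 h1)
  set f : Fin n → Fin n := fun x => if (z x).val < (z (s x)).val then s x else σ (s x) with hf
  have hff : ∀ x, f (f x) = σ x := by
    intro x
    by_cases h : (z x).val < (z (s x)).val
    · have e : f x = s x := if_pos h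
      rw [e]
      simp only [hf, hss, h.not_gt, if_false]
    · have e : f x = σ (s x) := if_neg h
      have h' : (z (s x)).val < (z x).val := lt_of_le_of_ne (not_lt.1 h) (hne x).symm
      rw [e]
      simp only [hf]
      rw [perm_commute_apply hs2, hss, hσ, hσ, if_pos h']
  have hinj : Function.Injective f := fun x y hxy => σ.injective (by rw [← hff, ← hff, hxy])
  refine ⟨Equiv.ofBijective f (Finite.injective_iff_bijective.1 hinj), ?_, fun x => rfl⟩
  refine (Finset.mem_filter_univ _).2 ⟨?_, c, hc, hc0, fun x => ?_⟩
  · ext x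
    exact congrArg Fin.val (hff x)
  · change z (f x) = z x + c
    simp only [hf]
    split_ifs
    · exact hz x
    · rw [hσ, hz]

theorem card_translateInvolutions (hgcd : Nat.gcd p n = 1 ∨ Nat.gcd p n = 2)
    (hσ : ∀ x, z (σ x) = z x) :
    (translateInvolutions p σ z).card = (translateRootsNe p σ z).card := by
  choose f hf hf' using fun s hs => exists_translateRoot (s := s) hgcd hσ hs
  choose g hg hg' using fun τ hτ => exists_translateInvolution (σ := σ) (z := z) hgcd (τ := τ) hτ
  refine Finset.card_bij' f g hf hg (fun s hs => ?_) (fun τ hτ => ?_)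
  · have h1 := hf s hs
    simp only [translateRootsNe, Finset.mem_filter_univ] at h1
    have hs1 := hs
    simp only [translateInvolutions, Finset.mem_filter_univ] at hs1
    apply Equiv.ext
    intro x
    have hz : z (f s hs x) = z (s x) := by
      rw [hf']
      split_ifs
      · rfl
      · rw [hσ]
    rw [hg', hz]
    split_ifs with h
    · rw [hf', if_pos h]
    · rw [Equiv.Perm.inv_eq_iff_eq, hf', apply_apply_of_mul_self hs1.1, if_pos]
      refine lt_of_le_of_ne (not_lt.1 h) fun e => ?_
      obtain ⟨-, -, c, -, hc0, hc⟩ := hs1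
      have h1 := ZMod.val_injective r e
      rw [hc] at h1
      exact hc0 (left_eq_add.1 h1.symm)
  · have h1 := hτ
    simp only [translateRootsNe, Finset.mem_filter_univ] at h1
    obtain ⟨h1, c, hc, hc0, hz⟩ := h1
    have h2 := two_mul_eq_zero_of_translate hgcd hc hz
    have hτi : ∀ x, τ (τ⁻¹ x) = x := τ.apply_symm_apply
    apply Equiv.ext
    intro x
    have hzg : z (g τ hτ x) = z (τ x) := by
      rw [hg']
      split_ifs
      · rfl
      · have := hz (τ⁻¹ x)
        rw [hτi] at this
        rw [hz]
        linear_combination -this - h2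
    rw [hf', hzg]
    split_ifs with h
    · rw [hg', if_pos h]
    · rw [hg', if_neg h]
      conv_lhs => rw [← h1]
      rw [Equiv.Perm.mul_apply, hτi]

/-- Now `σ` alternates the colours, so its colour-preserving powers on a point are the powers of `σ
^ 2`, and the signed count yields the roots of `σ ^ 2`. Multiplying such a root by `σ⁻¹` gives an
involution that translates `z` by `k`. -/
theorem sum_commInvolutions_of_translate [NeZero n] (hgcd : Nat.gcd p n = 1 ∨ Nat.gcd p n = 2)
    {k : ZMod r} (hk : (p : ZMod r) * k = 0) (hk0 : k ≠ 0) (hσ : ∀ x, z (σ x) = z x + k) :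
    ∑ s ∈ commInvolutions σ z, pairSign s σ = (translateInvolutions p σ z).card := by
  have h2 := two_mul_eq_zero_of_translate hgcd hk hσ
  have hzpow : ∀ (i : ℕ) x, z ((σ ^ i) x) = z x + i * k := by
    intro i x
    induction i with
    | zero => simp
    | succ i ih =>
      rw [pow_succ', Equiv.Perm.mul_apply, hσ, ih]
      push_cast
      ring
  rw [sum_pairSign_eq_card_commRoots (κ := σ ^ 2) rfl (fun x => by
    rw [hzpow]
    push_cast
    rw [h2, add_zero])]
  · rw [Nat.cast_inj]
    refine Finset.card_bij' (fun τ _ => σ⁻¹ * τ) (fun s _ => σ * s) (fun τ hτ => ?_)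
      (fun s hs => ?_) (fun τ _ => mul_inv_cancel_left _ _) (fun s _ => inv_mul_cancel_left _ _)
    · obtain ⟨h3, h4, h5⟩ := mem_commRoots.1 hτ
      have h6 : τ * σ⁻¹ = σ⁻¹ * τ := (show Commute τ σ from h4).inv_right
      refine (Finset.mem_filter_univ _).2 ⟨?_, ?_, k, hk, hk0, fun x => ?_⟩
      · rw [mul_assoc, ← mul_assoc τ, h6, mul_assoc, h3, sq]
        group
      · rw [mul_assoc, h4]
        group
      · have := hσ (σ⁻¹ (τ x))
        rw [show σ (σ⁻¹ (τ x)) = τ x from σ.apply_symm_apply _, h5] at this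
        rw [Equiv.Perm.mul_apply]
        linear_combination -this - h2
    · simp only [translateInvolutions, Finset.mem_filter_univ] at hs
      obtain ⟨h3, h4, c, hc, hc0, hz⟩ := hs
      have hck : c = k := eq_of_two_mul_eq_zero (two_mul_eq_zero_of_translate hgcd hc hz) hc0 h2 hk0
      refine mem_commRoots.2 ⟨?_, ?_, fun x => ?_⟩
      · rw [mul_assoc, ← mul_assoc s, h4, mul_assoc σ s s, h3, mul_one, sq]
      · rw [mul_assoc, h4]
      · rw [Equiv.Perm.mul_apply, hσ, hz, hck]
        linear_combination h2
  · intro x i hi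
    rw [hzpow, add_eq_left] at hi
    rcases Nat.even_or_odd' i with ⟨l, rfl | rfl⟩
    · exact ⟨l, by rw [pow_mul]⟩
    · push_cast at hi
      exact absurd (by linear_combination hi - l * h2) hk0

/-- The signed count of the involutions commuting with `σ` up to translation of `z` is the count
of the square roots of `σ` that translate `z`. -/
theorem sum_signed_involutions [NeZero n] (hgcd : Nat.gcd p n = 1 ∨ Nat.gcd p n = 2)
    (σ : Equiv.Perm (Fin n)) (z : Fin n → ZMod r) :
    ∑ s : Equiv.Perm (Fin n) with
        (s * s = 1 ∧ ∃ c : ZMod r, (p : ZMod r) * c = 0 ∧ ∀ i, z (s i) = z i + c) ∧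
        (s * σ = σ * s ∧ ∃ k : ZMod r, (p : ZMod r) * k = 0 ∧ ∀ i, z (σ i) = z i + k),
      (if ∀ i, z (s i) = z i then (pairSign s σ : ℂ) else ZMod.stdAddChar (z 0 - z (σ⁻¹ 0))) =
    (translateRoots p σ z).card := by
  -- The square of a translation by `c` is a translation by `2 * c = 0`.
  have hroot : ∀ τ ∈ translateRoots p σ z, ∀ i, z (σ i) = z i := by
    intro τ hτ i
    obtain ⟨rfl, c, hc, hz⟩ := (Finset.mem_filter_univ _).1 hτ
    rw [Equiv.Perm.mul_apply, hz, hz]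
    linear_combination two_mul_eq_zero_of_translate hgcd hc hz
  by_cases hk : ∃ k : ZMod r, (p : ZMod r) * k = 0 ∧ ∀ i, z (σ i) = z i + k
  swap
  · have h0 : translateRoots p σ z = ∅ := Finset.eq_empty_of_forall_notMem fun τ hτ =>
      hk ⟨0, mul_zero _, fun i => by rw [hroot τ hτ, add_zero]⟩
    simp [h0, hk]
  have hsplit : ∀ s : Equiv.Perm (Fin n), (s * s = 1 ∧ ∃ c : ZMod r, (p : ZMod r) * c = 0 ∧
      ∀ i, z (s i) = z i + c) ∧ (s * σ = σ * s ∧ ∃ k : ZMod r, (p : ZMod r) * k = 0 ∧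
      ∀ i, z (σ i) = z i + k) ↔ s ∈ commInvolutions σ z ∪ translateInvolutions p σ z := by
    intro s
    simp only [hk, and_true, Finset.mem_union, mem_commInvolutions, translateInvolutions,
      Finset.mem_filter_univ]
    constructor
    · rintro ⟨⟨h1, c, hc, hz⟩, h2⟩
      by_cases hc0 : c = 0
      · exact Or.inl ⟨h1, h2, fun i => by rw [hz, hc0, add_zero]⟩
      · exact Or.inr ⟨h1, h2, c, hc, hc0, hz⟩
    · rintro (⟨h1, h2, h3⟩ | ⟨h1, h2, c, hc, -, hz⟩)
      · exact ⟨⟨h1, 0, mul_zero _, fun i => by rw [h3, add_zero]⟩, h2⟩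
      · exact ⟨⟨h1, c, hc, hz⟩, h2⟩
  have hnot : ∀ s ∈ translateInvolutions p σ z, ¬ ∀ i, z (s i) = z i := by
    intro s hs h
    obtain ⟨-, -, c, -, hc0, hc⟩ := (Finset.mem_filter_univ _).1 hs
    have := hc 0
    rw [h] at this
    exact hc0 (left_eq_add.1 this)
  have hyes : ∀ s ∈ commInvolutions σ z, ∀ i, z (s i) = z i := fun s hs =>
    (mem_commInvolutions.1 hs).2.2
  have hdisj : Disjoint (commInvolutions σ z) (translateInvolutions p σ z) :=
    Finset.disjoint_left.2 fun s hs hs' => hnot s hs' (hyes s hs)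
  rw [Finset.filter_congr fun s _ => hsplit s, Finset.filter_mem_eq_inter, Finset.univ_inter,
    Finset.sum_union hdisj, Finset.sum_congr rfl fun s hs => if_pos (hyes s hs),
    Finset.sum_congr (g := fun _ => (ZMod.stdAddChar (z 0 - z (σ⁻¹ 0)) : ℂ)) rfl
      fun s hs => if_neg (hnot s hs), Finset.sum_const, nsmul_eq_mul, ← Int.cast_sum]
  obtain ⟨k, hk, hσ⟩ := hk
  have hu : z 0 - z (σ⁻¹ 0) = k := by
    have := hσ (σ⁻¹ 0)
    rw [show σ (σ⁻¹ 0) = 0 from σ.apply_symm_apply 0] at this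
    rw [this, add_sub_cancel_left]
  rw [hu]
  -- If `k = 0`, symmetric involutions match the colour-preserving roots and antisymmetric ones,
  -- with coefficient 1, the colour-moving roots. If `k ≠ 0`, there are no roots, and the
  -- antisymmetric terms have coefficient `-1` and cancel the symmetric sum.
  by_cases hk0 : k = 0
  · have hσ' : ∀ i, z (σ i) = z i := fun i => by rw [hσ, hk0, add_zero]
    have hroots : translateRoots p σ z = commRoots σ σ z ∪ translateRootsNe p σ z := by
      ext τ
      simp only [translateRoots, mem_commRoots, translateRootsNe, Finset.mem_union,
        Finset.mem_filter_univ]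
      constructor
      · rintro ⟨h1, c, hc, hz⟩
        by_cases hc0 : c = 0
        · exact Or.inl ⟨h1, by rw [← h1, mul_assoc], fun i => by rw [hz, hc0, add_zero]⟩
        · exact Or.inr ⟨h1, c, hc, hc0, hz⟩
      · rintro (⟨h1, -, h3⟩ | ⟨h1, c, hc, -, hz⟩)
        · exact ⟨h1, 0, mul_zero _, fun i => by rw [h3, add_zero]⟩
        · exact ⟨h1, c, hc, hz⟩
    have hd : Disjoint (commRoots σ σ z) (translateRootsNe p σ z) := by
      refine Finset.disjoint_left.2 fun τ h1 h2 => ?_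
      obtain ⟨-, -, h3⟩ := mem_commRoots.1 h1
      obtain ⟨-, c, -, hc0, hc⟩ := (Finset.mem_filter_univ _).1 h2
      have := hc 0
      rw [h3] at this
      exact hc0 (left_eq_add.1 this)
    rw [hroots, Finset.card_union_of_disjoint hd, ← card_translateInvolutions hgcd hσ', hk0,
      AddChar.map_zero_eq_one, mul_one,
      sum_pairSign_eq_card_commRoots (pow_one σ).symm hσ' fun x i _ => ⟨i, rfl⟩]
    push_cast
    rfl
  · have h0 : translateRoots p σ z = ∅ := Finset.eq_empty_of_forall_notMem fun τ hτ => by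
      have := hroot τ hτ 0
      rw [hσ] at this
      exact hk0 (add_eq_left.1 this)
    rw [h0, sum_commInvolutions_of_translate hgcd hk hk0 hσ,
      stdAddChar_eq_neg_one (two_mul_eq_zero_of_translate hgcd hk hσ) hk0]
    simp

end ColouredInvolutions

/-! ### The representation on absolute involutions -/

section Model

variable {r p n : ℕ}

theorem scalarGen_zpow (k : ℤ) :
    (scalarGen r p n) ^ k = ⟨1, fun _ => k * ((r / p : ℕ) : ZMod r)⟩ := by
  have hnat : ∀ m : ℕ, (scalarGen r p n) ^ m = ⟨1, fun _ => m * ((r / p : ℕ) : ZMod r)⟩ := by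
    intro m
    induction m with
    | zero => ext i <;> simp
    | succ m ih =>
      rw [pow_succ, ih]
      ext i
      · rfl
      · simp only [ColoredPerm.mul_color, scalarGen]
        push_cast
        ring
  obtain ⟨m, rfl | rfl⟩ := k.eq_nat_or_neg
  · rw [zpow_natCast, hnat]
    simp
  · rw [zpow_neg, zpow_natCast, hnat]
    ext i
    · simp
    · simp

variable [NeZero r]

theorem mem_scalarSubgroup (hpr : p ∣ r) (x : ColoredPerm r n) :
    x ∈ scalarSubgroup r p n ↔
      x.perm = 1 ∧ ∃ c : ZMod r, (p : ZMod r) * c = 0 ∧ ∀ i, x.color i = c := by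
  rw [scalarSubgroup, Subgroup.mem_zpowers_iff]
  constructor
  · rintro ⟨k, rfl⟩
    rw [scalarGen_zpow]
    refine ⟨rfl, (k : ZMod r) * ((r / p : ℕ) : ZMod r), ?_, fun i => rfl⟩
    rw [mul_left_comm, ← Nat.cast_mul, Nat.mul_div_cancel' hpr, ZMod.natCast_self, mul_zero]
  · rintro ⟨h1, c, hc, h2⟩
    obtain ⟨k, -, rfl⟩ := (mul_eq_zero_iff_exists_lt hpr c).1 hc
    refine ⟨k, ?_⟩
    rw [scalarGen_zpow]
    ext i
    · rw [h1]
    · rw [h2, mul_comm]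
      simp

theorem DualGroup.mk_eq_mk_iff (hpr : p ∣ r) (a b : ColoredPerm r n) :
    (a : DualGroup r p n) = b ↔
      a.perm = b.perm ∧ ∃ c : ZMod r, (p : ZMod r) * c = 0 ∧ ∀ i, b.color i = a.color i + c := by
  rw [QuotientGroup.eq, mem_scalarSubgroup hpr]
  rw [ColoredPerm.mul_perm, ColoredPerm.inv_perm, inv_mul_eq_one]
  refine and_congr_right fun h => exists_congr fun c => and_congr_right fun _ =>
    forall_congr' fun i => ?_
  rw [ColoredPerm.mul_color, ColoredPerm.inv_color, ← h,
    show a.perm⁻¹ (a.perm i) = i from a.perm.symm_apply_apply i, ← sub_eq_add_neg,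
    sub_eq_iff_eq_add']

theorem DualGroup.isAbsInv_mk_iff (hpr : p ∣ r) (v : ColoredPerm r n) :
    IsAbsInv (v : DualGroup r p n) ↔ v.perm * v.perm = 1 ∧
      ∃ c : ZMod r, (p : ZMod r) * c = 0 ∧ ∀ i, v.color (v.perm i) = v.color i + c := by
  have h : IsAbsInv (v : DualGroup r p n) ↔
      ((1 : ColoredPerm r n) : DualGroup r p n) = ((v * ColoredPerm.bar v : ColoredPerm r n)) :=
    eq_comm
  rw [h, mk_eq_mk_iff hpr, eq_comm]
  refine and_congr Iff.rfl (exists_congr fun c => and_congr_right fun _ => forall_congr' fun i => ?_)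
  change -v.color i + v.color (v.perm i) = 0 + c ↔ _
  rw [zero_add, neg_add_eq_iff_eq_add]

namespace ColoredPerm

theorem isSymm_iff (v : ColoredPerm r n) :
    v.IsSymm ↔ v.perm * v.perm = 1 ∧ ∀ i, v.color (v.perm i) = v.color i := by
  have hent : v.IsSymm ↔ ∀ i j, v.toMatrix i j = v.toMatrix j i :=
    ⟨fun h i j => congrFun (congrFun h j) i, fun h => Matrix.ext fun i j => h j i⟩
  rw [hent]
  constructor
  · intro h
    have key : ∀ i, v.perm (v.perm i) = i ∧ v.color (v.perm i) = v.color i := by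
      intro i
      have h1 := h (v.perm i) i
      simp only [toMatrix, Matrix.of_apply, if_true] at h1
      split_ifs at h1 with h2
      · rw [zetaPow_eq_stdAddChar, zetaPow_eq_stdAddChar] at h1
        exact ⟨h2.symm, (ZMod.injective_stdAddChar h1).symm⟩
      · exact absurd h1 (zetaPow_ne_zero _)
    exact ⟨Equiv.ext fun i => (key i).1, fun i => (key i).2⟩
  · rintro ⟨h1, h2⟩ i j
    have h3 := apply_apply_of_mul_self h1
    simp only [toMatrix, Matrix.of_apply]
    by_cases h : i = v.perm j
    · rw [h, h3, if_pos rfl, if_pos rfl, h2]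
    · rw [if_neg h, if_neg]
      intro h'
      exact h (by rw [h', h3])

omit [NeZero r] in
theorem not_isSymm_of_isAntisymm [NeZero n] {v : ColoredPerm r n} (h : v.IsAntisymm) :
    ¬ v.IsSymm := by
  intro h'
  have h1 : v.toMatrix = -v.toMatrix := h'.symm.trans h
  have h2 : v.toMatrix (v.perm 0) 0 = -v.toMatrix (v.perm 0) 0 := congrFun (congrFun h1 _) _
  have h3 : v.toMatrix (v.perm 0) 0 = zetaPow (v.color 0) := if_pos rfl
  rw [h3] at h2
  exact zetaPow_ne_zero _ (self_eq_neg.1 h2)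

omit [NeZero r] in
theorem neg_one_pow_invCount (v g : ColoredPerm r n) :
    (-1 : ℂ) ^ invCount v g = pairSign v.perm g.perm := by
  have h1 : invCount v g =
      Finset.card {x : Fin n | x < v.perm x ∧ ¬ g.perm x < g.perm (v.perm x)} := by
    refine Finset.card_bij' (fun x _ => x.1) (fun x _ => (x, v.perm x)) (fun x hx => ?_)
      (fun x hx => ?_) (fun x hx => ?_) (fun _ _ => rfl)
    · obtain ⟨h1, h2, h3⟩ := (Finset.mem_filter_univ x).1 hx
      exact (Finset.mem_filter_univ x.1).2 (by rw [h3]; exact ⟨h1, h2.not_gt⟩)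
    · obtain ⟨h1, h2⟩ := (Finset.mem_filter_univ x).1 hx
      exact (Finset.mem_filter_univ (x, v.perm x)).2
        ⟨h1, lt_of_le_of_ne (not_lt.1 h2) (g.perm.injective.ne h1.ne'), rfl⟩
    · obtain ⟨-, -, h3⟩ := (Finset.mem_filter_univ x).1 hx
      exact Prod.ext rfl h3
  rw [h1, pairSign]
  unfold ltSign
  rw [Finset.prod_ite, Finset.prod_const_one, one_mul, Finset.prod_const, Finset.filter_filter]
  push_cast
  rfl

omit [NeZero r] in
theorem conj_abs_perm (g v : ColoredPerm r n) :
    (g.abs * v * g.abs⁻¹).perm = g.perm * v.perm * g.perm⁻¹ := rfl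

omit [NeZero r] in
theorem conj_abs_color (g v : ColoredPerm r n) (i : Fin n) :
    (g.abs * v * g.abs⁻¹).color i = v.color (g.perm⁻¹ i) := by
  simp [abs]

theorem isSymm_conj_abs (g v : ColoredPerm r n) : (g.abs * v * g.abs⁻¹).IsSymm ↔ v.IsSymm := by
  rw [isSymm_iff, isSymm_iff, conj_abs_perm]
  simp only [conj_abs_color]
  refine and_congr ?_ ?_
  · rw [show g.perm * v.perm * g.perm⁻¹ * (g.perm * v.perm * g.perm⁻¹) =
      g.perm * (v.perm * v.perm) * g.perm⁻¹ by group]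
    exact conj_eq_one_iff
  · constructor
    · intro h i
      simpa using h (g.perm i)
    · intro h i
      simpa using h (g.perm⁻¹ i)

open scoped Classical in
/-- The coefficient with which `g` acts on the basis vector of (the class of) `v`. -/
noncomputable def modelCoeff [NeZero n] (g v : ColoredPerm r n) : ℂ :=
  zetaPow (pairing g v) * if v.IsSymm then (-1) ^ invCount v g else zetaPow (uDiff g v)

variable [NeZero n]

omit [NeZero r] in
theorem modelCoeff_of_isSymm {v : ColoredPerm r n} (hv : v.IsSymm) (g : ColoredPerm r n) :
    modelCoeff g v = zetaPow (pairing g v) * (-1) ^ invCount v g := by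
  rw [modelCoeff, if_pos hv]

omit [NeZero r] in
theorem modelCoeff_of_not_isSymm {v : ColoredPerm r n} (hv : ¬ v.IsSymm) (g : ColoredPerm r n) :
    modelCoeff g v = zetaPow (pairing g v) * zetaPow (uDiff g v) := by
  rw [modelCoeff, if_neg hv]

theorem modelCoeff_one (v : ColoredPerm r n) : modelCoeff 1 v = 1 := by
  have h0 : zetaPow (0 : ZMod r) = 1 := by
    rw [zetaPow_eq_stdAddChar, AddChar.map_zero_eq_one]
  have h1 : pairing 1 v = 0 := by simp [pairing]
  have h2 : uDiff 1 v = 0 := by simp [uDiff]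
  have h3 : invCount v 1 = 0 := by
    refine Finset.card_eq_zero.2 (Finset.filter_eq_empty_iff.2 fun x _ h => ?_)
    exact lt_asymm h.1 h.2.1
  rw [modelCoeff, h1, h2, h3, h0, pow_zero, ite_self, mul_one]

/-- All three ingredients are cocycles for conjugation by `|h|`, which preserves symmetry: the
pairing and `uDiff` additively, the inversion sign through `pairSign_mul`. With "not symmetric" in
the second branch, this holds without a condition on `GCD(p,n)`. -/
theorem modelCoeff_mul {v : ColoredPerm r n} (hv : v.perm * v.perm = 1) (g h : ColoredPerm r n) :
    modelCoeff (g * h) v = modelCoeff g (h.abs * v * h.abs⁻¹) * modelCoeff h v := by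
  have h1 : pairing (g * h) v = pairing g (h.abs * v * h.abs⁻¹) + pairing h v := by
    have e : pairing g (h.abs * v * h.abs⁻¹) = ∑ i, g.color (h.perm i) * v.color i := by
      simp only [pairing, conj_abs_color]
      rw [← Equiv.sum_comp h.perm]
      simp
    rw [e, pairing, pairing, ← Finset.sum_add_distrib]
    refine Finset.sum_congr rfl fun i _ => ?_
    rw [mul_color]
    ring
  have h2 : uDiff (g * h) v = uDiff g (h.abs * v * h.abs⁻¹) + uDiff h v := by
    simp only [uDiff, conj_abs_color, mul_perm, mul_inv_rev, Equiv.Perm.mul_apply]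
    ring
  by_cases hs : v.IsSymm
  · rw [modelCoeff_of_isSymm hs, modelCoeff_of_isSymm hs,
      modelCoeff_of_isSymm ((isSymm_conj_abs h v).2 hs), h1, zetaPow_add, neg_one_pow_invCount,
      neg_one_pow_invCount, neg_one_pow_invCount, conj_abs_perm, mul_perm, pairSign_mul hv]
    push_cast
    ring
  · rw [modelCoeff_of_not_isSymm hs, modelCoeff_of_not_isSymm hs,
      modelCoeff_of_not_isSymm (mt (isSymm_conj_abs h v).1 hs), h1, h2, zetaPow_add, zetaPow_add]
    ring

/-- Another lift adds to all colours a constant killed by `p`. The pairing changes by this constant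
times the total colour of `g`, a multiple of `p`; in `uDiff` the constant cancels. -/
theorem modelCoeff_congr (hpr : p ∣ r) {g v v' : ColoredPerm r n} (hg : g ∈ reflGroup r p n)
    (h : (v : DualGroup r p n) = v') : modelCoeff g v = modelCoeff g v' := by
  obtain ⟨h1, c, hc, h2⟩ := (DualGroup.mk_eq_mk_iff hpr v v').1 h
  obtain ⟨d, hd⟩ : (p : ZMod r) ∣ ∑ i, g.color i := hg
  have e1 : pairing g v' = pairing g v := by
    simp only [pairing, h2, mul_add, Finset.sum_add_distrib, ← Finset.sum_mul, hd]
    linear_combination d * hc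
  have e2 : uDiff g v' = uDiff g v := by
    simp only [uDiff, h2]
    ring
  have e3 : v'.IsSymm ↔ v.IsSymm := by
    rw [isSymm_iff, isSymm_iff, ← h1]
    simp only [h2, add_left_inj]
  by_cases hs : v.IsSymm
  · rw [modelCoeff_of_isSymm hs, modelCoeff_of_isSymm (e3.2 hs), e1, neg_one_pow_invCount,
      neg_one_pow_invCount, h1]
  · rw [modelCoeff_of_not_isSymm hs, modelCoeff_of_not_isSymm (mt e3.1 hs), e1, e2]

end ColoredPerm

open ColoredPerm

omit [NeZero r] in
theorem AbsInv.conj_one (v : AbsInv r p n) : AbsInv.conj 1 v = v := by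
  apply Subtype.ext
  change ((ColoredPerm.abs 1 : ColoredPerm r n) : DualGroup r p n) * v.1 *
    ((ColoredPerm.abs 1 : ColoredPerm r n) : DualGroup r p n)⁻¹ = v.1
  rw [show (ColoredPerm.abs 1 : ColoredPerm r n) = 1 from rfl, QuotientGroup.mk_one]
  simp

omit [NeZero r] in
theorem AbsInv.conj_mul (g h : ColoredPerm r n) (v : AbsInv r p n) :
    AbsInv.conj (g * h) v = AbsInv.conj g (AbsInv.conj h v) := by
  apply Subtype.ext
  have e : (g * h).abs = g.abs * h.abs := by
    ext i
    · rfl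
    · simp [ColoredPerm.abs]
  change (((g * h).abs : ColoredPerm r n) : DualGroup r p n) * v.1 *
    (((g * h).abs : ColoredPerm r n) : DualGroup r p n)⁻¹ = (g.abs : DualGroup r p n) *
    ((h.abs : DualGroup r p n) * v.1 * (h.abs : DualGroup r p n)⁻¹) * (g.abs : DualGroup r p n)⁻¹
  rw [e, QuotientGroup.mk_mul]
  group

variable [NeZero n]

/-- The coefficient with which `g` acts on the basis vector `C_v`. -/
noncomputable def AbsInv.coeff (g : ColoredPerm r n) (v : AbsInv r p n) : ℂ :=
  modelCoeff g (Quotient.out v.1)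

theorem AbsInv.coeff_mk (hpr : p ∣ r) {g v : ColoredPerm r n} (hg : g ∈ reflGroup r p n)
    (hv : DualGroup.IsAbsInv (v : DualGroup r p n)) :
    AbsInv.coeff g (⟨v, hv⟩ : AbsInv r p n) = modelCoeff g v :=
  modelCoeff_congr hpr hg (QuotientGroup.out_eq' _)

/-- The linear map by which `g` acts on the model. -/
noncomputable def modelMap (p : ℕ) (g : ColoredPerm r n) : ModelSpace r p n →ₗ[ℂ] ModelSpace r p n :=
  Finsupp.linearCombination ℂ fun v => AbsInv.coeff g v • basisC (AbsInv.conj g v)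

omit [NeZero r] in
theorem modelMap_basisC (g : ColoredPerm r n) (v : AbsInv r p n) :
    modelMap p g (basisC v) = AbsInv.coeff g v • basisC (AbsInv.conj g v) := by
  rw [modelMap, basisC, Finsupp.linearCombination_single, one_smul]

/-- The representation of `G(r,p,n)` on the formal span of the absolute involutions of its dual
group. -/
noncomputable def modelRep (hpr : p ∣ r) :
    Representation ℂ (reflGroup r p n) (ModelSpace r p n) where
  toFun g := modelMap p g.1
  map_one' := by
    refine Finsupp.lhom_ext' fun v => LinearMap.ext_ring ?_
    change modelMap p 1 (basisC v) = basisC v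
    rw [modelMap_basisC, AbsInv.conj_one, AbsInv.coeff, modelCoeff_one, one_smul]
  map_mul' g h := by
    refine Finsupp.lhom_ext' fun v => LinearMap.ext_ring ?_
    change modelMap p (g.1 * h.1) (basisC v) = modelMap p g.1 (modelMap p h.1 (basisC v))
    obtain ⟨v, hv⟩ := v
    induction v using QuotientGroup.induction_on with
    | H v =>
      have h1 := ((DualGroup.isAbsInv_mk_iff hpr v).1 hv).1
      rw [modelMap_basisC, modelMap_basisC, map_smul, modelMap_basisC, smul_smul, AbsInv.conj_mul,
        AbsInv.coeff_mk hpr (mul_mem g.2 h.2), AbsInv.coeff_mk hpr h.2, modelCoeff_mul h1, mul_comm]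
      congr 2
      exact (AbsInv.coeff_mk hpr g.2 (AbsInv.conj h.1 ⟨v, hv⟩).2).symm

end Model

/-! ### The character of the model -/

section ModelCharacter

open ColoredPerm

variable {r p n : ℕ} [NeZero r]

theorem card_scalarSubgroup [NeZero n] (hpr : p ∣ r) : Nat.card (scalarSubgroup r p n) = p := by
  have e : scalarSubgroup r p n ≃ {c : ZMod r // (p : ZMod r) * c = 0} :=
    { toFun := fun x => ⟨x.1.color 0, by
        obtain ⟨-, c, hc, h⟩ := (mem_scalarSubgroup hpr x.1).1 x.2
        rw [h, hc]⟩
      invFun := fun c => ⟨⟨1, fun _ => c.1⟩, (mem_scalarSubgroup hpr _).2 ⟨rfl, c.1, c.2, fun _ => rfl⟩⟩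
      left_inv := fun x => by
        obtain ⟨h1, c, hc, h⟩ := (mem_scalarSubgroup hpr x.1).1 x.2
        apply Subtype.ext
        ext i
        · rw [h1]
        · change x.1.color 0 = x.1.color i
          rw [h, h]
      right_inv := fun c => rfl }
  rw [Nat.card_congr e, Nat.card_eq_fintype_card, Fintype.card_subtype, card_filter_mul_eq_zero hpr]

/-- Every class has `p` lifts. The resulting factor `p` is the one that appears in
`mul_card_barRoots`. -/
theorem mul_sum_dualGroup [NeZero n] [Fintype (DualGroup r p n)] (hpr : p ∣ r)
    (F : DualGroup r p n → ℂ) : (p : ℂ) * ∑ q, F q = ∑ v : ColoredPerm r n, F v := by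
  classical
  rw [← Finset.sum_fiberwise Finset.univ (fun v : ColoredPerm r n => (v : DualGroup r p n)),
    Finset.mul_sum]
  refine Finset.sum_congr rfl fun q _ => ?_
  rw [Finset.sum_congr rfl fun v hv => by rw [(Finset.mem_filter.1 hv).2], Finset.sum_const,
    nsmul_eq_mul]
  congr 2
  have h := QuotientGroup.card_preimage_mk (scalarSubgroup r p n) {q}
  rw [card_scalarSubgroup hpr, show Nat.card ({q} : Set (DualGroup r p n)) = 1 from Nat.card_unique,
    mul_one] at h
  refine h.symm.trans ?_
  rw [Nat.card_eq_card_toFinset]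
  congr 1
  ext v
  simp

theorem modelRep_character [NeZero n] [Fintype (AbsInv r p n)] [DecidableEq (AbsInv r p n)]
    (hpr : p ∣ r) (g : reflGroup r p n) :
    (modelRep hpr).character g =
      ∑ v : AbsInv r p n, if AbsInv.conj g.1 v = v then AbsInv.coeff g.1 v else 0 := by
  rw [Representation.character,
    LinearMap.trace_eq_matrix_trace ℂ (Finsupp.basisSingleOne (ι := AbsInv r p n)), Matrix.trace]
  refine Finset.sum_congr rfl fun v _ => ?_
  rw [Matrix.diag_apply, LinearMap.toMatrix_apply, Finsupp.coe_basisSingleOne]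
  change modelMap p g.1 (basisC v) v = _
  rw [modelMap_basisC, Finsupp.smul_apply, basisC, Finsupp.single_apply, smul_eq_mul, mul_ite,
    mul_one, mul_zero]

-- The action permutes the basis up to scalars, so the trace collects the coefficients of the fixed
-- basis vectors, here summed over lifts.
open scoped Classical in
theorem mul_modelRep_character [NeZero n] (hpr : p ∣ r) (g : reflGroup r p n) :
    (p : ℂ) * (modelRep hpr).character g = ∑ v : ColoredPerm r n,
      if DualGroup.IsAbsInv (v : DualGroup r p n) ∧
        ((g.1.abs * v * g.1.abs⁻¹ : ColoredPerm r n) : DualGroup r p n) = v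
      then modelCoeff g.1 v else 0 := by
  have : Fintype (DualGroup r p n) := Fintype.ofFinite _
  have : Fintype (AbsInv r p n) := Fintype.ofFinite _
  let F : DualGroup r p n → ℂ := fun q => if h : DualGroup.IsAbsInv q then
    (if AbsInv.conj g.1 ⟨q, h⟩ = ⟨q, h⟩ then AbsInv.coeff g.1 (⟨q, h⟩ : AbsInv r p n) else 0) else 0
  have h1 : (modelRep hpr).character g = ∑ q, F q := by
    rw [modelRep_character hpr,
      ← Finset.sum_filter_of_ne (p := fun q => DualGroup.IsAbsInv q) fun q _ hq => by
        by_contra h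
        exact hq (dif_neg h),
      Finset.sum_subtype _ (fun q => Finset.mem_filter_univ q)]
    refine Finset.sum_congr rfl fun v _ => ?_
    simp only [F]
    rw [dif_pos v.2]
  rw [h1, mul_sum_dualGroup hpr]
  refine Finset.sum_congr rfl fun v _ => ?_
  by_cases hv : DualGroup.IsAbsInv (v : DualGroup r p n)
  · simp only [F, hv, dif_pos, true_and, AbsInv.coeff_mk hpr g.2 hv]
    exact if_congr Subtype.ext_iff rfl rfl
  · simp only [F, hv, dif_neg, not_false_eq_true, false_and, if_false]

theorem isAbsInv_and_conj_eq_iff (hpr : p ∣ r) (g v : ColoredPerm r n) :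
    (DualGroup.IsAbsInv (v : DualGroup r p n) ∧
      ((g.abs * v * g.abs⁻¹ : ColoredPerm r n) : DualGroup r p n) = v) ↔
    (v.perm * v.perm = 1 ∧
      ∃ c : ZMod r, (p : ZMod r) * c = 0 ∧ ∀ i, v.color (v.perm i) = v.color i + c) ∧
    (v.perm * g.perm = g.perm * v.perm ∧
      ∃ k : ZMod r, (p : ZMod r) * k = 0 ∧ ∀ i, v.color (g.perm i) = v.color i + k) := by
  rw [DualGroup.isAbsInv_mk_iff hpr, DualGroup.mk_eq_mk_iff hpr]
  refine and_congr Iff.rfl (and_congr ?_ (exists_congr fun k => and_congr_right fun _ => ?_))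
  · rw [conj_abs_perm, mul_inv_eq_iff_eq_mul, eq_comm]
  · simp only [conj_abs_color]
    constructor
    · intro h i
      simpa using h (g.perm i)
    · intro h i
      simpa using h (g.perm⁻¹ i)

theorem modelRep_character_eq_card [NeZero n] (hpr : p ∣ r)
    (hgcd : Nat.gcd p n = 1 ∨ Nat.gcd p n = 2) [Fintype (reflGroup r p n)]
    [DecidableEq (reflGroup r p n)] (g : reflGroup r p n) :
    (modelRep hpr).character g =
      (Finset.card {h : reflGroup r p n | h * reflGroup.bar h = g} : ℂ) := by
  classical
  have hp : (p : ℂ) ≠ 0 := Nat.cast_ne_zero.2 fun h => NeZero.ne r (by simpa [h] using hpr)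
  apply mul_left_cancel₀ hp
  rw [mul_card_barRoots hpr, mul_modelRep_character hpr]
  simp_rw [isAbsInv_and_conj_eq_iff hpr]
  -- The colour vector `z` is made the outer variable: for fixed `z` the factor `ζ_r ^ ⟨g, z⟩` is
  -- common to both sides, leaving the comparison of involutions with square roots.
  rw [← Equiv.sum_comp equivProd.symm, Fintype.sum_prod_type, Finset.sum_comm]
  refine Finset.sum_congr rfl fun z _ => ?_
  rw [← sum_signed_involutions hgcd, ← Finset.sum_filter, Finset.mul_sum]
  refine Finset.sum_congr (Finset.filter_congr fun s _ => Iff.rfl) fun s hs => ?_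
  have hs1 : s * s = 1 := ((Finset.mem_filter.1 hs).2).1.1
  change modelCoeff g.1 ⟨s, z⟩ = _
  have hiff : (⟨s, z⟩ : ColoredPerm r n).IsSymm ↔ ∀ i, z (s i) = z i := by
    rw [isSymm_iff]
    exact and_iff_right hs1
  by_cases h : ∀ i, z (s i) = z i
  · rw [if_pos h, modelCoeff_of_isSymm (hiff.2 h), neg_one_pow_invCount, zetaPow_eq_stdAddChar]
    rfl
  · rw [if_neg h, modelCoeff_of_not_isSymm (mt hiff.1 h), zetaPow_eq_stdAddChar,
      zetaPow_eq_stdAddChar]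
    rfl

end ModelCharacter

theorem mainTheorem1 (r p n : ℕ) [NeZero r] [NeZero n] (hpr : p ∣ r)
    (hgcd : Nat.gcd p n = 1 ∨ Nat.gcd p n = 2) :
    ∃ ρ : Representation ℂ (reflGroup r p n) (ModelSpace r p n),
      (∀ (g : reflGroup r p n) (v : ColoredPerm r n)
          (hv : DualGroup.IsAbsInv (v : DualGroup r p n)),
        (v.IsSymm →
          ρ g (basisC ⟨v, hv⟩) =
            (zetaPow (ColoredPerm.pairing g.1 v) * (-1) ^ ColoredPerm.invCount v g.1) •
              basisC (AbsInv.conj g.1 ⟨v, hv⟩)) ∧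
        (v.IsAntisymm →
          ρ g (basisC ⟨v, hv⟩) =
            (zetaPow (ColoredPerm.pairing g.1 v) * zetaPow (ColoredPerm.uDiff g.1 v)) •
              basisC (AbsInv.conj g.1 ⟨v, hv⟩))) ∧
      IsModel.{u} ρ := by
  classical
  have : Fintype (reflGroup r p n) := Fintype.ofFinite _
  refine ⟨modelRep hpr, fun g v hv => ⟨fun h => ?_, fun h => ?_⟩, ?_⟩
  · change modelMap p g.1 _ = _
    rw [modelMap_basisC, AbsInv.coeff_mk hpr g.2, ColoredPerm.modelCoeff_of_isSymm h]
  · change modelMap p g.1 _ = _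
    rw [modelMap_basisC, AbsInv.coeff_mk hpr g.2,
      ColoredPerm.modelCoeff_of_not_isSymm (ColoredPerm.not_isSymm_of_isAntisymm h)]
  · exact isModel_of_character_eq_card reflGroup.bar reflGroup.bar_bar
      (reflGroup.isConj_inv_bar hpr hgcd) (modelRep hpr)
      (fun g => modelRep_character_eq_card hpr hgcd g)
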